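/- **Definitions.** The ambient space is $S=\mathbb R^3$ or $S=S^3=\mathbb R^3\cup\{\infty\}$. A *knot* is the image of a topological embedding of the circle in $S$, a *link* is a finite union of pairwise disjoint knots, and "knot" below may also mean "link". A *tame ball* is the image of the closed unit ball of $\mathbb R^3$ under a homeomorphism of $S$. For $q\in K$, the *penetration index* ($p$-index) $P(K,q)$ is the least $n$ such that every neighborhood of $q$ contains a tame ball $B$ that is itself a neighborhood of $q$ and whose boundary meets $K$ in exactly $n$ points; $P(K,q)=\infty$ if there is no such integer. *Mosaics.* The tiles are the eleven standard knot mosaic tiles $T_0,\dots,T_{10}$ (empty; four quarter arcs joining adjacent sides; two straight arcs; two pairs of disjoint quarter arcs; two crossings) and the tile $T_\infty$, which has connection points either on two opposite sides or on all four sides. An *$RV_{2,4}$ tangle $n$-mosaic* ($n\ge 1$) is an $n\times n$ matrix of tiles such that, on every common side of two adjacent tiles, both or neither have a connection point, no two $T_\infty$ tiles are adjacent, and no $T_\infty$ tile lies along the boundary. It is a *knot mosaic* if moreover it has no connection points on the boundary of the square. The symmetry group $D_4$ of the square acts on $n$-mosaics by moving and turning the tiles (the reflection in the NW--SE diagonal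 is realized by the half turn of space about that diagonal, so it fixes both crossing tiles). *Tree mosaics.* A *tree mosaic* $\mathcal M=(T,F,i)$ consists of a countable locally finite rooted tree $T$, a mosaic $F(v)$ of dimension $\dim F(v)$ for each vertex $v$, and, for each edge from a parent $u$ to a child $w$, a position in $F(u)$ and a symmetry $g_{uw}\in D_4$. It is *well-defined* if, for each $v$, the edges from $v$ to its children target the $T_\infty$ tiles of $F(v)$ bijectively. It is *suitably connected* if $F(\text{root})$ is a knot mosaic, every other $F(v)$ is a tangle mosaic of odd dimension at least $3$, and for every edge $(u,w)$ the mosaic $g_{uw}\cdot F(w)$ has exactly one boundary connection point on each side on which the targeted $T_\infty$ tile of $F(u)$ has one, and none on the other sides. *Realization.* In an $n$-mosaic the tile in row $i$ and column $j$ is realized in the cube $[i-1,i]\times[j-1,j]\times[0,1]$ (first coordinate southward, second eastward) by disjoint standard PL arcs joining the centers of the faces that correspond to the sides with connection points, with interiors in the open cube; $T_\infty$ contributes nothing. Set $G(\text{root})=e$, $\sigma(\text{root})=1$, $\rho(\text{root})=0$, and for a child $w$ of $u$ set $G(w)=G(u)g_{uw}$, $\sigma(w)=\sigma(u)/\dim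 F(w)$ and $\rho(w)=\rho(u)+\sigma(u)(a-1,b-1,0)$, where $(a,b)$ is the position in $G(u)\cdot F(u)$ of the $T_\infty$ tile targeted by $(u,w)$. Then $|\mathcal M|\subset\mathbb R^3$ is the closure of the union of all $\sigma(v)\,|G(v)\cdot F(v)|+\rho(v)$ and of the straight segments that join, for every edge $(u,w)$, each connection point on the cube of the targeted $T_\infty$ tile to the corresponding boundary connection point of $G(w)\cdot F(w)$ (both placed in space by the scales and positions of $u$ and $w$). A *tree mosaic representative* of $K\subset S$ is a well-defined, suitably connected tree mosaic $\mathcal M$ such that some homeomorphism of $S$ carries $|\mathcal M|$ onto $K$. **Theorem.** Let $K$ be a knot (or link) in $\mathbb R^3$ or $S^3$. If there is a point $p\in K$ with $P(K,p)>4$, then $K$ has no tree mosaic representative. -/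

import Mathlib

open Topology

universe u

/-- Euclidean three-space. -/
abbrev E3 : Type := EuclideanSpace ℝ (Fin 3)

/-! ## Knots, links and the penetration index

The ambient space `X` is `ℝ³` or `S³ = ℝ³ ∪ {∞}`; it comes with the standard inclusion
`e : ℝ³ → X` (the identity, respectively the inclusion in the one-point compactification). -/

section Ambient

variable {X : Type*} [TopologicalSpace X]

/-- A knot: a simple closed curve, that is the image of a topological embedding of the circle. -/
def IsKnot (K : Set X) : Prop :=
  ∃ γ : Circle → X, IsEmbedding γ ∧ Set.range γ = K

/-- A link: a finite union of pairwise disjoint knots. -/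
def IsLink (K : Set X) : Prop :=
  ∃ (n : ℕ) (C : Fin n → Set X),
    (∀ i, IsKnot (C i)) ∧ (∀ i j, i ≠ j → Disjoint (C i) (C j)) ∧ K = ⋃ i, C i

/-- A tame closed ball: the image of the round closed ball under a homeomorphism of the
ambient space. -/
def IsTameBall (e : E3 → X) (B : Set X) : Prop :=
  ∃ h : X ≃ₜ X, B = h '' (e '' Metric.closedBall (0 : E3) 1)

/-- The penetration index of `q` in `K`: the least `n` such that there are arbitrarily small
ball neighbourhoods of `q` whose boundary meets `K` in `n` points (`⊤` if there is no such
integer). -/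
noncomputable def pIndex (e : E3 → X) (K : Set X) (q : X) : ℕ∞ :=
  sInf {n : ℕ∞ | ∀ W ∈ 𝓝 q, ∃ B : Set X,
    IsTameBall e B ∧ B ∈ 𝓝 q ∧ B ⊆ W ∧ (K ∩ frontier B).encard = n}

end Ambient

/-! ## Tiles -/

/-- The four sides of a square tile. -/
inductive Side
  | N | S | E | W
  deriving DecidableEq

/-- The opposite side. -/
def Side.opp : Side → Side
  | .N => .S
  | .S => .N
  | .E => .W
  | .W => .E

/-- The connection data of a `T_∞` tile: two opposite sides, or all four sides. -/
inductive VertexType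
  | NS | EW | NSEW
  deriving DecidableEq

/-- The tiles `T₀, …, T₁₀`, and the tile `T_∞` with its connection data. -/
inductive Tile
  | T0 | T1 | T2 | T3 | T4 | T5 | T6 | T7 | T8 | T9 | T10
  | Tinf (d : VertexType)
  deriving DecidableEq

namespace Tile

/-- The tile is a `T_∞` tile. -/
def IsInf : Tile → Prop
  | Tinf _ => True
  | _ => False

/-- The sides of the tile that carry a connection point. -/
def conn : Tile → Finset Side
  | T0 => ∅
  | T1 => {.W, .S}
  | T2 => {.S, .E}
  | T3 => {.N, .E}
  | T4 => {.N, .W}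
  | T5 => {.E, .W}
  | T6 => {.N, .S}
  | T7 | T8 | T9 | T10 => {.N, .S, .E, .W}
  | Tinf .NS => {.N, .S}
  | Tinf .EW => {.E, .W}
  | Tinf .NSEW => {.N, .S, .E, .W}

/-- The quarter turn of a tile: `N → E → S → W → N`. -/
def rot : Tile → Tile
  | T0 => T0
  | T1 => T4
  | T2 => T1
  | T3 => T2
  | T4 => T3
  | T5 => T6
  | T6 => T5
  | T7 => T8
  | T8 => T7
  | T9 => T10
  | T10 => T9
  | Tinf .NS => Tinf .EW
  | Tinf .EW => Tinf .NS
  | Tinf .NSEW => Tinf .NSEW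

/-- The flip of a tile about the NW–SE diagonal: `N ↔ W`, `S ↔ E`. It is a half turn of space
about the diagonal, so it exchanges over and under and fixes the two crossing tiles. -/
def flip : Tile → Tile
  | T1 => T3
  | T3 => T1
  | T5 => T6
  | T6 => T5
  | Tinf .NS => Tinf .EW
  | Tinf .EW => Tinf .NS
  | t => t

end Tile

/-- A position in an `n × n` matrix; rows are numbered from north to south and columns from
west to east, starting with `0`. -/
@[ext] structure Pos (n : ℕ) where
  row : Fin n
  col : Fin n
  deriving DecidableEq

namespace Pos

variable {n : ℕ}

/-- The quarter turn of the square, sending north to east. -/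
def rot (p : Pos n) : Pos n := ⟨p.col, p.row.rev⟩

/-- The reflection of the square in the NW–SE diagonal. -/
def flip (p : Pos n) : Pos n := ⟨p.col, p.row⟩

/-- `q` is the neighbour of `p` on the side `s`. -/
def Nbr : Side → Pos n → Pos n → Prop
  | .N, p, q => (q.row : ℕ) + 1 = p.row ∧ q.col = p.col
  | .S, p, q => (q.row : ℕ) = p.row + 1 ∧ q.col = p.col
  | .E, p, q => (q.col : ℕ) = p.col + 1 ∧ q.row = p.row
  | .W, p, q => (q.col : ℕ) + 1 = p.col ∧ q.row = p.row

/-- The side `s` of the tile at `p` lies on the boundary of the square. -/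
def OnBoundary : Side → Pos n → Prop
  | .N, p => (p.row : ℕ) = 0
  | .S, p => (p.row : ℕ) + 1 = n
  | .E, p => (p.col : ℕ) + 1 = n
  | .W, p => (p.col : ℕ) = 0

end Pos

/-! ## The action of the dihedral group of the square -/

/-- The map by which `g : DihedralGroup 4` acts if `r 1` and `sr 0` act as `rot` and `flip`. -/
def dihedralMap {α : Type*} (rot flip : α → α) : DihedralGroup 4 → α → α
  | .r i, x => rot^[i.val] x
  | .sr i, x => flip (rot^[i.val] x)

theorem dihedralMap_mul {α : Type*} (rot flip : α → α)
    (h₁ : ∀ x, rot (rot (rot (rot x))) = x) (h₂ : ∀ x, flip (flip x) = x)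
    (h₃ : ∀ x, rot (flip (rot x)) = flip x) (g h : DihedralGroup 4) (x : α) :
    dihedralMap rot flip (g * h) x = dihedralMap rot flip g (dihedralMap rot flip h x) := by
  have h₄ : ∀ x, rot (flip x) = flip (rot (rot (rot x))) := fun x => by
    have := h₃ (rot (rot (rot x)))
    rwa [h₁] at this
  have v0 : (0 : ZMod 4).val = 0 := rfl
  have v1 : (1 : ZMod 4).val = 1 := rfl
  have v2 : (2 : ZMod 4).val = 2 := rfl
  have v3 : (3 : ZMod 4).val = 3 := rfl
  have key : ∀ i : ZMod 4, i = 0 ∨ i = 1 ∨ i = 2 ∨ i = 3 := by decide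
  have a11 : (1 + 1 : ZMod 4) = 2 := rfl
  have a12 : (1 + 2 : ZMod 4) = 3 := rfl
  have a13 : (1 + 3 : ZMod 4) = 0 := rfl
  have a21 : (2 + 1 : ZMod 4) = 3 := rfl
  have a22 : (2 + 2 : ZMod 4) = 0 := rfl
  have a23 : (2 + 3 : ZMod 4) = 1 := rfl
  have a31 : (3 + 1 : ZMod 4) = 0 := rfl
  have a32 : (3 + 2 : ZMod 4) = 1 := rfl
  have a33 : (3 + 3 : ZMod 4) = 2 := rfl
  have n1 : (-1 : ZMod 4) = 3 := rfl
  have n2 : (-2 : ZMod 4) = 2 := rfl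
  have n3 : (-3 : ZMod 4) = 1 := rfl
  rcases g with i | i <;> rcases h with j | j <;>
    rcases key i with rfl | rfl | rfl | rfl <;> rcases key j with rfl | rfl | rfl | rfl <;>
    simp only [DihedralGroup.r_mul_r, DihedralGroup.r_mul_sr, DihedralGroup.sr_mul_r,
      DihedralGroup.sr_mul_sr, dihedralMap, sub_eq_add_neg, neg_zero, n1, n2, n3, zero_add,
      add_zero, a11, a12, a13, a21, a22, a23, a31, a32, a33, v0, v1, v2, v3,
      Function.iterate_succ, Function.iterate_zero, Function.comp, id, h₁, h₂, h₄]

instance : MulAction (DihedralGroup 4) Tile where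
  smul := dihedralMap Tile.rot Tile.flip
  one_smul _ := rfl
  mul_smul := dihedralMap_mul _ _
    (by rintro (_ | _ | _ | _ | _ | _ | _ | _ | _ | _ | _ | (_ | _ | _)) <;> rfl)
    (by rintro (_ | _ | _ | _ | _ | _ | _ | _ | _ | _ | _ | (_ | _ | _)) <;> rfl)
    (by rintro (_ | _ | _ | _ | _ | _ | _ | _ | _ | _ | _ | (_ | _ | _)) <;> rfl)

instance (n : ℕ) : MulAction (DihedralGroup 4) (Pos n) where
  smul := dihedralMap Pos.rot Pos.flip
  one_smul _ := rfl
  mul_smul := dihedralMap_mul _ _ (by simp [Pos.rot]) (by simp [Pos.flip])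
    (by simp [Pos.rot, Pos.flip])

/-! ## Mosaics -/

/-- An `RV_{2,4}` `n`-mosaic: an `n × n` matrix of tiles. -/
abbrev Mosaic (n : ℕ) : Type := Pos n → Tile

namespace Mosaic

variable {n : ℕ}

/-- The action of the dihedral group on mosaics: the tiles are moved and are themselves turned. -/
def turn (g : DihedralGroup 4) (M : Mosaic n) : Mosaic n := fun p => g • M (g⁻¹ • p)

/-- Every connection point of a tile meets a connection point of the contiguous tile. -/
def TilesConnected (M : Mosaic n) : Prop :=
  ∀ s p q, Pos.Nbr s p q → (s ∈ (M p).conn ↔ s.opp ∈ (M q).conn)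

/-- `RV_{2,4}` tangle `n`-mosaics: the tiles are suitably connected, no two `T_∞` tiles are
adjacent, and no `T_∞` tile lies along the boundary. -/
def IsTangle (M : Mosaic n) : Prop :=
  0 < n ∧ M.TilesConnected ∧
    (∀ s p q, Pos.Nbr s p q → ¬ ((M p).IsInf ∧ (M q).IsInf)) ∧
    (∀ s p, Pos.OnBoundary s p → ¬ (M p).IsInf)

/-- The boundary connection points of a mosaic on the side `s`, given by their tiles. -/
def boundaryPoints (M : Mosaic n) (s : Side) : Set (Pos n) :=
  {p | Pos.OnBoundary s p ∧ s ∈ (M p).conn}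

/-- `RV_{2,4}` knot `n`-mosaics: tangle mosaics without boundary connection points. -/
def IsKnotMosaic (M : Mosaic n) : Prop :=
  M.IsTangle ∧ ∀ s, M.boundaryPoints s = ∅

end Mosaic

/-! ## Tree mosaics -/

/-- A `σ`-oriented embedding of mosaics `x_{ij}^σ` into an `n`-mosaic: the position `(i, j)` of
the targeted tile and the symmetry `σ` that is applied to the inserted mosaic. -/
structure OrientedEmbedding (n : ℕ) where
  pos : Pos n
  orient : DihedralGroup 4

/-- A tree mosaic `(T, F, i)`. The vertices of the rooted tree are ordered by ancestry, with the
root `⊥`; the edges are the pairs `u ⋖ w` with `u` the parent of `w`. -/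
structure TreeMosaic where
  tree : RootedTree.{u}
  countable : Countable tree
  locallyFinite : ∀ v : tree, {w : tree | v ⋖ w}.Finite
  dim : tree → ℕ
  F : ∀ v : tree, Mosaic (dim v)
  emb : ∀ {u w : tree}, u ⋖ w → OrientedEmbedding (dim u)

namespace TreeMosaic

/-- The embeddings along the edges to the children of `v` target the `T_∞` tiles of `F v`
bijectively. -/
def WellDefined (M : TreeMosaic.{u}) : Prop :=
  ∀ v : M.tree, Set.BijOn (fun w : {w : M.tree // v ⋖ w} => (M.emb w.2).pos) Set.univ
    {p | (M.F v p).IsInf}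

/-- Suitable connectedness. In the last clause, the inserted mosaic has exactly one boundary
connection point on each side on which the targeted tile has a connection point, and none on the
other sides. -/
def SuitablyConnected (M : TreeMosaic.{u}) : Prop :=
  (M.F ⊥).IsKnotMosaic ∧
  (∀ v : M.tree, v ≠ ⊥ → (M.F v).IsTangle ∧ Odd (M.dim v) ∧ 3 ≤ M.dim v) ∧
  (∀ (u w : M.tree) (h : u ⋖ w) (s : Side),
    (((M.F w).turn (M.emb h).orient).boundaryPoints s).ncard =
      if s ∈ (M.F u (M.emb h).pos).conn then 1 else 0)

end TreeMosaic

/-! ## Geometric realization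

The tile in row `i` and column `j` (numbered from `0`) occupies the cube
`[i, i + 1] × [j, j + 1] × [0, 1]`. Thus the first coordinate increases from north to south and
the second one from west to east. -/

/-- The connection point on the side `s` of the unit cube: the centre of that face. -/
noncomputable def faceCenter : Side → E3
  | .N => !₂[0, 1/2, 1/2]
  | .S => !₂[1, 1/2, 1/2]
  | .E => !₂[1/2, 1, 1/2]
  | .W => !₂[1/2, 0, 1/2]

/-- The straight arc between the connection points on the sides `s` and `t`. -/
noncomputable def straightArc (s t : Side) : Set E3 :=
  segment ℝ (faceCenter s) (faceCenter t)

/-- The arc between the connection points on the opposite sides `s` and `t` that passes through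
the point at height `z` above the centre of the square. -/
noncomputable def bentArc (z : ℝ) (s t : Side) : Set E3 :=
  segment ℝ (faceCenter s) !₂[1/2, 1/2, z] ∪ segment ℝ !₂[1/2, 1/2, z] (faceCenter t)

/-- The arcs of a tile in the unit cube; a `T_∞` tile contributes nothing. -/
noncomputable def Tile.arcs : Tile → Set E3
  | T0 => ∅
  | T1 => straightArc .W .S
  | T2 => straightArc .S .E
  | T3 => straightArc .N .E
  | T4 => straightArc .N .W
  | T5 => straightArc .W .E
  | T6 => straightArc .N .S
  | T7 => straightArc .W .S ∪ straightArc .N .E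
  | T8 => straightArc .S .E ∪ straightArc .N .W
  | T9 => bentArc (3/4) .W .E ∪ bentArc (1/4) .N .S
  | T10 => bentArc (1/4) .W .E ∪ bentArc (3/4) .N .S
  | Tinf _ => ∅

/-- The lowest corner of the cube of the tile at position `p`. -/
noncomputable def Pos.corner {n : ℕ} (p : Pos n) : E3 := !₂[(p.row : ℕ), (p.col : ℕ), 0]

/-- The realization of a mosaic, using only its tiles `T₀, …, T₁₀`. -/
noncomputable def Mosaic.tame {n : ℕ} (M : Mosaic n) : Set E3 :=
  ⋃ p : Pos n, (fun x => p.corner + x) '' (M p).arcs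

namespace TreeMosaic

/-- Where a vertex is realized: the scale factor, the position, and the product of the symmetries
of the oriented embeddings along the path from the root. -/
structure Frame where
  scale : ℝ
  position : E3
  orient : DihedralGroup 4

/-- The map `x ↦ σ • x + ρ` of a frame. -/
noncomputable def Frame.map (f : Frame) (x : E3) : E3 := f.scale • x + f.position

variable (M : TreeMosaic.{u})

/-- The frame of a child `w` of `u` in terms of the frame of `u`. -/
noncomputable def childFrame (f : Frame) {u w : M.tree} (h : u ⋖ w) : Frame where
  scale := f.scale / M.dim w
  position := f.map (f.orient • (M.emb h).pos).corner
  orient := f.orient * (M.emb h).orient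

/-- The depth of a vertex: its distance from the root. -/
noncomputable def depth (v : M.tree) : ℕ := sInf {k | Order.pred^[k] v = ⊥}

open Classical in
/-- The frame of `v`, computed along the last `k` edges of the path from the root to `v`. -/
noncomputable def frameAux : ℕ → M.tree → Frame
  | 0, _ => ⟨1, 0, 1⟩
  | k + 1, v =>
    if hv : v = ⊥ then ⟨1, 0, 1⟩
    else M.childFrame (frameAux k (Order.pred v))
      (Order.pred_covBy_of_not_isMin (fun h => hv h.eq_bot))

/-- The frame of a vertex: scale `1`, position `0` and trivial orientation at the root, and
determined by `childFrame` along the edges. -/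
noncomputable def frame (v : M.tree) : Frame := M.frameAux (M.depth v) v

/-- The mosaic of the vertex `v` as it is placed in space. -/
noncomputable def placed (v : M.tree) : Mosaic (M.dim v) := (M.F v).turn (M.frame v).orient

/-- The connecting segments of an edge: they join the connection points of the targeted tile to
the boundary connection points on the same side of the inserted mosaic. -/
noncomputable def connecting {u w : M.tree} (h : u ⋖ w) : Set E3 :=
  ⋃ (s : Side) (p ∈ (M.placed w).boundaryPoints s),
    segment ℝ
      ((M.frame u).map (((M.frame u).orient • (M.emb h).pos).corner + faceCenter s))
      ((M.frame w).map (p.corner + faceCenter s))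

/-- The geometric realization of a tree mosaic. -/
noncomputable def realization : Set E3 :=
  closure ((⋃ v : M.tree, (M.frame v).map '' (M.placed v).tame) ∪
    ⋃ (u : M.tree) (w : M.tree) (h : u ⋖ w), M.connecting h)

/-- The tree mosaic is a representative of `K`: its realization is ambient homeomorphic
to `K`. -/
def Represents {X : Type*} [TopologicalSpace X] (e : E3 → X) (K : Set X) : Prop :=
  M.WellDefined ∧ M.SuitablyConnected ∧ ∃ h : X ≃ₜ X, h '' (e '' M.realization) = K

end TreeMosaic

/-!
The theorem follows from a bound that holds at every point of the realization `R` of a tree mosaic: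
around every `x ∈ R` there are arbitrarily small tame balls the boundary of which meets `R` in at
most four points (`TreeMosaic.exists_ball`). Such balls are carried over to the ambient space by
`pIndex_image_le`; since the number of intersection points takes only finitely many values, one of
them occurs for arbitrarily small balls, so the penetration index is at most four.

Everything is read in the coordinates of a vertex `v`. There, the part of `R` that belongs to the
subtree of `v` consists of the arcs of the mosaic of `v` and, in the cube of each `T_∞` tile, of the
connecting segments of a child, which run on the vertical faces of the cube, and a scaled copy of
the part of `R` that belongs to the child (`TreeMosaic.localBelow_eq`, abstractly
`InsertedMosaic`). Two facts keep these pieces apart. The arcs of a tile lie in an octahedron that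
meets each vertical face of the cube only in its centre; and the part inserted into a cube avoids
its vertical edges, because a mosaic has connection points only in the middle of the sides of its
tiles. Moreover the `T_∞` tiles are not adjacent, and over the interior of the square of `v` there
is nothing of `R` except the subtree of `v`.

Now let `x ∈ R`. Descend from the root to a child as long as `x` lies over the interior of the
square of the child and belongs to the subtree of the child. If this stops at some vertex, then
near `x` the set `R` is a finite union of segments, at most two of which contain `x`, so small
round spheres around `x` meet `R` in at most four points (`InsertedMosaic.branchLE_four`). If it
does not stop, then `x` lies in a sequence of cubes of `T_∞` tiles that shrink to a point, the scale
being divided by at least three in every step. Such a cube, slightly enlarged, is a convex body and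
hence a tame ball, and its boundary meets `R` only in the arcs of the four adjacent tiles, in at
most one point on each side (`InsertedMosaic.encard_inter_frontier_box_le`).
-/

/-! ### The penetration index -/

section Penetration

variable {X : Type*} [TopologicalSpace X]

/-- If the number of intersection points is bounded by `N` for arbitrarily small tame balls, then
one of the finitely many values up to `N` is attained for arbitrarily small balls. -/
theorem pIndex_le_of_forall_nhds {e : E3 → X} {K : Set X} {q : X} {N : ℕ}
    (H : ∀ W ∈ 𝓝 q, ∃ B : Set X,
      IsTameBall e B ∧ B ∈ 𝓝 q ∧ B ⊆ W ∧ (K ∩ frontier B).encard ≤ N) :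
    pIndex e K q ≤ N := by
  by_contra! hlt
  have hbad : ∀ n : Fin (N + 1), ∃ W ∈ 𝓝 q, ∀ B : Set X,
      IsTameBall e B → B ∈ 𝓝 q → B ⊆ W → (K ∩ frontier B).encard ≠ (n : ℕ) := by
    intro n
    by_contra! hn
    refine absurd hlt (not_lt.2 (le_trans (sInf_le (a := ((n : ℕ) : ℕ∞)) ?_) ?_))
    · intro W hW
      obtain ⟨B, h1, h2, h3, h4⟩ := hn W hW
      exact ⟨B, h1, h2, h3, h4⟩
    · exact_mod_cast Nat.lt_succ_iff.1 n.2
  choose W hW hWbad using hbad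
  obtain ⟨B, h1, h2, h3, h4⟩ := H (⋂ n, W n) (Filter.iInter_mem.2 hW)
  obtain ⟨m, hm⟩ := ENat.ne_top_iff_exists.1 (ne_top_of_le_ne_top (ENat.natCast_ne_top N) h4)
  rw [← hm] at h4
  have hmN : m < N + 1 := Nat.lt_succ_iff.2 (by exact_mod_cast h4)
  exact hWbad ⟨m, hmN⟩ B h1 h2 (h3.trans (Set.iInter_subset _ _)) hm.symm

/-- A bound for the number of intersection points of `R ⊆ ℝ³` with small tame balls around every
point of `R` bounds the penetration index of every homeomorphic copy of `R` in the ambient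
space. -/
theorem pIndex_image_le [T2Space X] {e : E3 → X} (he : IsOpenEmbedding e)
    (hext : ∀ g : E3 ≃ₜ E3, ∃ g' : X ≃ₜ X, ∀ x, g' (e x) = e (g x)) {N : ℕ} {R : Set E3}
    (hR : ∀ x ∈ R, ∀ V ∈ 𝓝 x, ∃ g : E3 ≃ₜ E3, g '' Metric.closedBall 0 1 ∈ 𝓝 x ∧
      g '' Metric.closedBall 0 1 ⊆ V ∧
      (R ∩ frontier (g '' Metric.closedBall 0 1)).encard ≤ N)
    (h : X ≃ₜ X) {p : X} (hp : p ∈ h '' (e '' R)) :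
    pIndex e (h '' (e '' R)) p ≤ N := by
  obtain ⟨_, ⟨x, hx, rfl⟩, rfl⟩ := hp
  refine pIndex_le_of_forall_nhds fun W hW => ?_
  have hcont : Continuous fun y => h (e y) := h.continuous.comp he.continuous
  obtain ⟨g, hg1, hg2, hg3⟩ := hR x hx _ (hcont.continuousAt.preimage_mem_nhds hW)
  obtain ⟨g', hg'⟩ := hext g
  set B₀ : Set E3 := g '' Metric.closedBall 0 1 with hB₀
  have hB : h '' (e '' B₀) = (g'.trans h) '' (e '' Metric.closedBall 0 1) := by
    simp only [hB₀, Set.image_image, Homeomorph.trans_apply, hg']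
  have hcl : IsClosed (h '' (e '' B₀)) :=
    ((((isCompact_closedBall (0 : E3) 1).image g.continuous).image he.continuous).image
      h.continuous).isClosed
  have hfr : frontier (h '' (e '' B₀)) ⊆ h '' (e '' frontier B₀) := by
    intro y hy
    rw [hcl.frontier_eq] at hy
    obtain ⟨⟨_, ⟨b, hb, rfl⟩, rfl⟩, hy2⟩ := hy
    refine ⟨_, ⟨b, ⟨subset_closure hb, fun hbi => hy2 ?_⟩, rfl⟩, rfl⟩
    have ho : IsOpen (h '' (e '' interior B₀)) :=
      h.isOpenMap _ (he.isOpenMap _ isOpen_interior)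
    exact interior_maximal (Set.image_mono (Set.image_mono interior_subset)) ho
      ⟨_, ⟨b, hbi, rfl⟩, rfl⟩
  refine ⟨h '' (e '' B₀), ⟨g'.trans h, hB⟩, ?_, ?_, ?_⟩
  · exact h.isOpenMap.image_mem_nhds (he.isOpenMap.image_mem_nhds hg1)
  · rintro _ ⟨_, ⟨b, hb, rfl⟩, rfl⟩
    exact hg2 hb
  · have hinj : Function.Injective fun y => h (e y) := h.injective.comp he.injective
    have hsub : h '' (e '' R) ∩ frontier (h '' (e '' B₀)) ⊆
        (fun y => h (e y)) '' (R ∩ frontier B₀) := by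
      rintro _ ⟨⟨_, ⟨y, hy, rfl⟩, rfl⟩, hy2⟩
      obtain ⟨_, ⟨b, hb, rfl⟩, hbe⟩ := hfr hy2
      obtain rfl : b = y := hinj hbe
      exact ⟨b, ⟨hy, hb⟩, rfl⟩
    exact (Set.encard_le_encard hsub).trans (hinj.encard_image _ |>.le.trans hg3)

end Penetration

/-- A compact convex body in `ℝ³` is the image of the closed unit ball under a homeomorphism of
`ℝ³`. -/
theorem exists_homeomorph_image_closedBall_eq {s : Set E3} (hc : Convex ℝ s) (hs : IsCompact s)
    (hne : (interior s).Nonempty) : ∃ g : E3 ≃ₜ E3, g '' Metric.closedBall 0 1 = s := by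
  obtain ⟨h, -, h2, -⟩ :=
    exists_homeomorph_image_interior_closure_frontier_eq_unitBall hc hne hs.isBounded
  refine ⟨h.symm, ?_⟩
  rw [← h2, hs.isClosed.closure_eq, Set.image_image]
  simp

/-! ### Branches at a point -/

/-- The set `A` has at most `m` branches at `x`: all sufficiently small spheres around `x` meet `A`
in at most `m` points. -/
def BranchLE (A : Set E3) (x : E3) (m : ℕ∞) : Prop :=
  ∀ᶠ r in 𝓝[>] (0 : ℝ), (A ∩ Metric.sphere x r).encard ≤ m

namespace BranchLE

variable {A B : Set E3} {x : E3} {m k : ℕ∞}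

theorem mono (h : BranchLE A x m) (hBA : B ⊆ A) (hmk : m ≤ k) : BranchLE B x k :=
  Filter.Eventually.mono h fun _ hr =>
    ((Set.encard_le_encard (Set.inter_subset_inter_left _ hBA)).trans hr).trans hmk

theorem union (hA : BranchLE A x m) (hB : BranchLE B x k) : BranchLE (A ∪ B) x (m + k) := by
  filter_upwards [hA, hB] with r h1 h2
  rw [Set.union_inter_distrib_right]
  exact (Set.encard_union_le _ _).trans (add_le_add h1 h2)

theorem congr_nhds {U : Set E3} (hA : BranchLE A x m) (hU : U ∈ 𝓝 x) (hBA : B ∩ U ⊆ A) :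
    BranchLE B x m := by
  obtain ⟨ε, hε, hU⟩ := Metric.mem_nhds_iff.1 hU
  filter_upwards [hA, Ioo_mem_nhdsGT hε] with r h1 hr
  refine le_trans (Set.encard_le_encard ?_) h1
  intro y hy
  refine ⟨hBA ⟨hy.1, hU ?_⟩, hy.2⟩
  rw [Metric.mem_ball, Metric.mem_sphere.1 hy.2]
  exact hr.2

theorem of_notMem (hA : IsClosed A) (hx : x ∉ A) : BranchLE A x 0 := by
  have : BranchLE ∅ x 0 := Filter.Eventually.of_forall fun r => by simp
  exact this.congr_nhds (hA.isOpen_compl.mem_nhds hx) (by simp)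

/-- A line meets every sphere in at most two points. -/
theorem of_collinear (hA : Collinear ℝ A) : BranchLE A x 2 := by
  refine Filter.Eventually.of_forall fun r => ?_
  by_contra! hlt
  obtain ⟨t, ht, htc⟩ := Set.exists_subset_encard_eq (Order.add_one_le_of_lt hlt)
  obtain ⟨a, b, c, hab, hac, hbc, rfl⟩ := Set.encard_eq_three.1 (htc.trans two_add_one_eq_three)
  have ha := ht (Set.mem_insert a {b, c})
  have hb := ht (Set.mem_insert_of_mem a (Set.mem_insert b {c}))
  have hc := ht (Set.mem_insert_of_mem a (Set.mem_insert_of_mem b (Set.mem_singleton c)))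
  have hcos : EuclideanGeometry.Cospherical (A ∩ Metric.sphere x r) := ⟨x, r, fun p hp => hp.2⟩
  have := hcos.affineIndependent_of_mem_of_ne ha hb hc hab hac hbc
  rw [affineIndependent_iff_not_collinear_set] at this
  refine this (hA.subset ?_)
  rintro y (rfl | rfl | rfl)
  exacts [ha.1, hb.1, hc.1]

theorem segment (a b : E3) : BranchLE (segment ℝ a b) x 2 := by
  refine of_collinear ?_
  rw [collinear_iff_exists_forall_eq_smul_vadd]
  refine ⟨a, b - a, fun p hp => ?_⟩
  rw [segment_eq_image'] at hp
  obtain ⟨t, -, rfl⟩ := hp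
  exact ⟨t, by simp [add_comm]⟩

/-- A finite union of closed sets that pairwise do not meet at `x` has at most as many branches as
one of the sets. -/
theorem iUnion_of_subsingleton {ι : Type*} [Finite ι] {A : ι → Set E3} (hcl : ∀ i, IsClosed (A i))
    (hsub : ∀ i j, x ∈ A i → x ∈ A j → i = j) (h : ∀ i, x ∈ A i → BranchLE (A i) x m) :
    BranchLE (⋃ i, A i) x m := by
  by_cases hx : ∃ i, x ∈ A i
  · obtain ⟨i, hi⟩ := hx
    have hcl' : IsClosed (⋃ j : {j // j ≠ i}, A j) := isClosed_iUnion_of_finite fun j => hcl j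
    have hx' : x ∉ ⋃ j : {j // j ≠ i}, A j := by
      rintro hx
      obtain ⟨j, hj⟩ := Set.mem_iUnion.1 hx
      exact j.2 (hsub _ _ hj hi)
    refine ((h i hi).union (of_notMem hcl' hx')).mono ?_ (by simp)
    refine Set.iUnion_subset fun j y hy => ?_
    by_cases hj : j = i
    · exact Or.inl (hj ▸ hy)
    · exact Or.inr (Set.mem_iUnion.2 ⟨⟨j, hj⟩, hy⟩)
  · have := of_notMem (isClosed_iUnion_of_finite hcl) (x := x) (by simpa using hx)
    exact this.mono le_rfl (by simp)

/-- The number of branches is invariant under homotheties. -/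
theorem image_homothety {c : ℝ} (hc : 0 < c) (b : E3) (hA : BranchLE A x m) :
    BranchLE ((fun y => c • y + b) '' A) (c • x + b) m := by
  have ht : Filter.Tendsto (fun r : ℝ => c⁻¹ * r) (𝓝[>] 0) (𝓝[>] 0) := by
    refine tendsto_nhdsWithin_iff.2 ⟨?_, ?_⟩
    · have : Filter.Tendsto (fun r : ℝ => c⁻¹ * r) (𝓝 0) (𝓝 (c⁻¹ * 0)) :=
        (continuous_const.mul continuous_id).tendsto 0
      rw [mul_zero] at this
      exact this.mono_left nhdsWithin_le_nhds
    · filter_upwards [self_mem_nhdsWithin] with r hr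
      exact mul_pos (inv_pos.2 hc) hr
  filter_upwards [ht.eventually hA] with r hr
  refine le_trans (Set.encard_le_encard ?_) ((Set.encard_image_le (fun y => c • y + b) _).trans hr)
  rintro _ ⟨⟨y, hy, rfl⟩, hs⟩
  refine ⟨y, ⟨hy, ?_⟩, rfl⟩
  rw [Metric.mem_sphere, dist_add_right, dist_smul₀, Real.norm_of_nonneg hc.le] at hs
  rw [Metric.mem_sphere, ← hs]
  field_simp

/-- If `A` has at most `N` branches at `x`, then small round balls around `x` meet `A` in at most
`N` boundary points. -/
theorem exists_ball {N : ℕ} (hA : BranchLE A x N) {V : Set E3} (hV : V ∈ 𝓝 x) :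
    ∃ g : E3 ≃ₜ E3, g '' Metric.closedBall 0 1 ∈ 𝓝 x ∧ g '' Metric.closedBall 0 1 ⊆ V ∧
      (A ∩ frontier (g '' Metric.closedBall 0 1)).encard ≤ N := by
  obtain ⟨ε, hε, hεV⟩ := Metric.mem_nhds_iff.1 hV
  obtain ⟨r, hr, hr0, hrε⟩ := (hA.and (Ioo_mem_nhdsGT hε)).exists
  obtain ⟨g, hg⟩ := exists_homeomorph_image_closedBall_eq (convex_closedBall x r)
    (isCompact_closedBall x r) ⟨x, by
      rw [interior_closedBall _ hr0.ne']; exact Metric.mem_ball_self hr0⟩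
  refine ⟨g, ?_⟩
  rw [hg, frontier_closedBall _ hr0.ne']
  exact ⟨Metric.closedBall_mem_nhds x hr0, (Metric.closedBall_subset_ball hrε).trans hεV, hr⟩

end BranchLE

/-! ### The arcs of a tile -/

theorem exists_coord_of_mem_segment {a b y : E3} (hy : y ∈ segment ℝ a b) :
    ∃ t : ℝ, 0 ≤ t ∧ t ≤ 1 ∧ ∀ i, y i = a i + t * (b i - a i) := by
  rw [segment_eq_image'] at hy
  obtain ⟨t, ht, rfl⟩ := hy
  exact ⟨t, ht.1, ht.2, fun i => by simp⟩

theorem abs_convexComb_sub_le {a b : ℝ} (ha : 0 ≤ a) (hb : 0 ≤ b) (hab : a + b = 1) (x y c : ℝ) :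
    |a * x + b * y - c| ≤ a * |x - c| + b * |y - c| := by
  have : a * x + b * y - c = a * (x - c) + b * (y - c) := by linear_combination c * hab
  rw [this]
  refine (abs_add_le _ _).trans ?_
  rw [abs_mul, abs_mul, abs_of_nonneg ha, abs_of_nonneg hb]

/-- The octahedron spanned by the four face centres of the unit cube and the two points at
heights `1/4` and `3/4` above the centre of the square. It meets each vertical face of the cube in
the centre of the face only. -/
def tileOct : Set E3 := {y | |y 0 - 1/2| + |y 1 - 1/2| + 2 * |y 2 - 1/2| ≤ 1/2}

theorem convex_tileOct : Convex ℝ tileOct := by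
  intro x hx y hy a b ha hb hab
  simp only [tileOct, Set.mem_ofPred_eq, PiLp.add_apply, PiLp.smul_apply, smul_eq_mul] at *
  have h0 := abs_convexComb_sub_le ha hb hab (x 0) (y 0) (1/2)
  have h1 := abs_convexComb_sub_le ha hb hab (x 1) (y 1) (1/2)
  have h2 := abs_convexComb_sub_le ha hb hab (x 2) (y 2) (1/2)
  have hx' := mul_le_mul_of_nonneg_left hx ha
  have hy' := mul_le_mul_of_nonneg_left hy hb
  have : a * (1/2) + b * (1/2) = (1/2 : ℝ) := by rw [← add_mul, hab, one_mul]
  linarith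

theorem faceCenter_mem_tileOct (s : Side) : faceCenter s ∈ tileOct := by
  cases s <;> simp [faceCenter, tileOct] <;> norm_num

theorem apex_mem_tileOct {z : ℝ} (h1 : 1/4 ≤ z) (h2 : z ≤ 3/4) :
    (!₂[1/2, 1/2, z] : E3) ∈ tileOct := by
  have : |z - 1/2| ≤ 1/4 := abs_le.2 ⟨by linarith, by linarith⟩
  simp [tileOct] at this ⊢
  linarith

theorem straightArc_subset_tileOct (s t : Side) : straightArc s t ⊆ tileOct :=
  convex_tileOct.segment_subset (faceCenter_mem_tileOct s) (faceCenter_mem_tileOct t)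

theorem bentArc_subset_tileOct {z : ℝ} (h1 : 1/4 ≤ z) (h2 : z ≤ 3/4) (s t : Side) :
    bentArc z s t ⊆ tileOct :=
  Set.union_subset
    (convex_tileOct.segment_subset (faceCenter_mem_tileOct s) (apex_mem_tileOct h1 h2))
    (convex_tileOct.segment_subset (apex_mem_tileOct h1 h2) (faceCenter_mem_tileOct t))

theorem Tile.arcs_subset_tileOct (t : Tile) : t.arcs ⊆ tileOct := by
  cases t <;> simp only [Tile.arcs, Set.union_subset_iff, Set.empty_subset,
    straightArc_subset_tileOct, and_self]
  all_goals
    constructor <;> exact bentArc_subset_tileOct (by norm_num) (by norm_num) _ _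

/-- The distance of a point from the plane of a vertical face of the unit cube, measured
inwards. -/
def sideDepth : Side → E3 → ℝ
  | .N, y => y 0
  | .S, y => 1 - y 0
  | .E, y => 1 - y 1
  | .W, y => y 1

/-- The slopes of the arc of a tile that starts at a given side, in the horizontal direction along
the side and in the vertical direction. -/
noncomputable def Tile.slope : Tile → Side → ℝ × ℝ
  | T1, .W => (1, 0)
  | T1, .S => (-1, 0)
  | T2, .S => (1, 0)
  | T2, .E => (1, 0)
  | T3, .N => (1, 0)
  | T3, .E => (-1, 0)
  | T4, .N => (-1, 0)
  | T4, .W => (-1, 0)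
  | T7, .W => (1, 0)
  | T7, .S => (-1, 0)
  | T7, .N => (1, 0)
  | T7, .E => (-1, 0)
  | T8, .S => (1, 0)
  | T8, .E => (1, 0)
  | T8, .N => (-1, 0)
  | T8, .W => (-1, 0)
  | T9, .W => (0, 1/2)
  | T9, .E => (0, 1/2)
  | T9, .N => (0, -1/2)
  | T9, .S => (0, -1/2)
  | T10, .W => (0, -1/2)
  | T10, .E => (0, -1/2)
  | T10, .N => (0, 1/2)
  | T10, .S => (0, 1/2)
  | _, _ => (0, 0)

/-- The direction of the arc of a tile that starts at a given side. -/
noncomputable def Tile.direction (t : Tile) : Side → E3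
  | .N => !₂[1, (t.slope .N).1, (t.slope .N).2]
  | .S => !₂[-1, (t.slope .S).1, (t.slope .S).2]
  | .E => !₂[(t.slope .E).1, -1, (t.slope .E).2]
  | .W => !₂[(t.slope .W).1, 1, (t.slope .W).2]

/-- In the half of the unit cube next to the side `s`, the arcs of a tile lie on a line through the
centre of that side. -/
theorem Tile.eq_of_mem_arcs (t : Tile) (s : Side) {y : E3} (hy : y ∈ t.arcs)
    (hd : sideDepth s y < 1/2) : y = faceCenter s + sideDepth s y • t.direction s := by
  have key : ∀ a b : E3, y ∈ segment ℝ a b → ∃ τ : ℝ, 0 ≤ τ ∧ τ ≤ 1 ∧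
      y 0 = a 0 + τ * (b 0 - a 0) ∧ y 1 = a 1 + τ * (b 1 - a 1) ∧
      y 2 = a 2 + τ * (b 2 - a 2) := fun a b h => by
    obtain ⟨τ, h1, h2, h3⟩ := exists_coord_of_mem_segment h
    exact ⟨τ, h1, h2, h3 0, h3 1, h3 2⟩
  cases t <;> simp only [Tile.arcs, straightArc, bentArc, Set.mem_union,
    Set.mem_empty_iff_false] at hy
  case' T7 => rcases hy with hy | hy
  case' T8 => rcases hy with hy | hy
  case' T9 => rcases hy with (hy | hy) | hy | hy
  case' T10 => rcases hy with (hy | hy) | hy | hy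
  all_goals
    obtain ⟨τ, h1, h2, h3, h4, h5⟩ := key _ _ hy
    clear hy key
    cases s <;> simp [faceCenter, sideDepth, Tile.direction, Tile.slope] at h3 h4 h5 hd ⊢
  all_goals first
    | (exfalso; linarith)
    | (ext i; fin_cases i <;> simp <;> linarith)

namespace BranchLE

variable {y : E3}

/-- Off the vertical axis of its cube, a tile has at most two branches. -/
theorem arcs_of_sideDepth_lt (t : Tile) (s : Side) (hd : sideDepth s y < 1/2) :
    BranchLE t.arcs y 2 := by
  have hcont : Continuous (sideDepth s) := by
    cases s <;> unfold sideDepth <;> fun_prop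
  have hU : {z | sideDepth s z < 1/2} ∈ 𝓝 y :=
    (isOpen_lt hcont continuous_const).mem_nhds hd
  refine (of_collinear (A := t.arcs ∩ {z | sideDepth s z < 1/2}) ?_).congr_nhds hU subset_rfl
  rw [collinear_iff_exists_forall_eq_smul_vadd]
  refine ⟨faceCenter s, t.direction s, fun p hp => ⟨sideDepth s p, ?_⟩⟩
  rw [vadd_eq_add, add_comm]
  exact t.eq_of_mem_arcs s hp.1 hp.2

theorem bentArc (z : ℝ) (s t : Side) : BranchLE (bentArc z s t) y 4 :=
  ((segment _ _).union (segment _ _)).mono subset_rfl (by norm_num)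

end BranchLE

theorem isClosed_segment (a b : E3) : IsClosed (segment ℝ a b) := by
  rw [← convexHull_pair]
  exact ((Set.toFinite {a, b}).isCompact_convexHull ℝ).isClosed

theorem isClosed_bentArc (z : ℝ) (s t : Side) : IsClosed (bentArc z s t) :=
  (isClosed_segment _ _).union (isClosed_segment _ _)

theorem Tile.isClosed_arcs (t : Tile) : IsClosed t.arcs := by
  cases t <;> simp only [Tile.arcs, straightArc, bentArc, isClosed_empty] <;>
    repeat' first | exact isClosed_segment _ _ | apply IsClosed.union

/-- A tile has at most four branches at every point: the two strands of a crossing tile are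
disjoint, and each consists of two segments. -/
theorem BranchLE.arcs (t : Tile) (y : E3) : BranchLE t.arcs y 4 := by
  have h24 : (2 : ℕ∞) ≤ 4 := by norm_num
  have hs : ∀ s, sideDepth s y < 1/2 → BranchLE t.arcs y 4 := fun s h =>
    (BranchLE.arcs_of_sideDepth_lt t s h).mono subset_rfl h24
  by_cases hN : y 0 < 1/2
  · exact hs .N hN
  by_cases hS : 1/2 < y 0
  · exact hs .S (by simp only [sideDepth]; linarith)
  by_cases hW : y 1 < 1/2
  · exact hs .W hW
  by_cases hE : 1/2 < y 1
  · exact hs .E (by simp only [sideDepth]; linarith)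
  have h0 : y 0 = 1/2 := by linarith
  have h1 : y 1 = 1/2 := by linarith
  -- on the vertical axis, the strand through the apex at height `z` has height `z`
  have hbent : ∀ (z : ℝ) (s : Side), y ∈ _root_.bentArc z s s.opp → y 2 = z := by
    intro z s h
    cases s <;> simp only [_root_.bentArc, Side.opp] at h <;> rcases h with h | h <;>
      obtain ⟨τ, h3, h4, h5⟩ := exists_coord_of_mem_segment h <;>
      have h50 := h5 0 <;> have h51 := h5 1 <;> have h52 := h5 2 <;>
      simp [faceCenter] at h50 h51 h52 <;> clear h5 h <;>
      first
        | (have hτ : τ = 1 := by linarith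
           rw [h52, hτ]; ring)
        | (have hτ : τ = 0 := by linarith
           rw [h52, hτ]; ring)
  have hcross : ∀ (z z' : ℝ), z ≠ z' →
      BranchLE (_root_.bentArc z .W .E ∪ _root_.bentArc z' .N .S) y 4 := by
    intro z z' hz
    by_cases h : y ∈ _root_.bentArc z .W .E
    · have h' : y ∉ _root_.bentArc z' .N .S := fun h' =>
        hz ((hbent z .W h).symm.trans (hbent z' .N h'))
      exact ((BranchLE.bentArc _ _ _).union
        (BranchLE.of_notMem (isClosed_bentArc _ _ _) h')).mono subset_rfl (by norm_num)
    · exact ((BranchLE.of_notMem (isClosed_bentArc _ _ _) h).union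
        (BranchLE.bentArc _ _ _)).mono subset_rfl (by norm_num)
  have hempty : BranchLE ∅ y 4 :=
    (BranchLE.of_notMem isClosed_empty (by simp)).mono subset_rfl (by norm_num)
  cases t <;> simp only [Tile.arcs, straightArc]
  case T0 => exact hempty
  case Tinf => exact hempty
  case T7 | T8 =>
    exact ((BranchLE.segment _ _).union (BranchLE.segment _ _)).mono subset_rfl (by norm_num)
  case T9 | T10 => exact hcross _ _ (by norm_num)
  all_goals exact (BranchLE.segment _ _).mono subset_rfl h24

/-! ### The symmetries of the square -/

/-- The map `π` of sides is compatible with the action of `g` on positions and tiles. -/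
structure SideCompatible (g : DihedralGroup 4) (π : Side → Side) : Prop where
  nbr : ∀ {n : ℕ} {s : Side} {p q : Pos n}, Pos.Nbr s p q → Pos.Nbr (π s) (g • p) (g • q)
  onBoundary : ∀ {n : ℕ} {s : Side} {p : Pos n}, Pos.OnBoundary s p → Pos.OnBoundary (π s) (g • p)
  conn : ∀ {s : Side} {t : Tile}, s ∈ t.conn → π s ∈ (g • t).conn
  isInf : ∀ {t : Tile}, t.IsInf → (g • t).IsInf

theorem SideCompatible.mul {g h : DihedralGroup 4} {π θ : Side → Side} (hg : SideCompatible g π)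
    (hh : SideCompatible h θ) : SideCompatible (g * h) (π ∘ θ) where
  nbr H := by rw [mul_smul, mul_smul]; exact hg.nbr (hh.nbr H)
  onBoundary H := by rw [mul_smul]; exact hg.onBoundary (hh.onBoundary H)
  conn H := by rw [mul_smul]; exact hg.conn (hh.conn H)
  isInf H := by rw [mul_smul]; exact hg.isInf (hh.isInf H)

theorem sideCompatible_one : SideCompatible 1 id where
  nbr H := by simpa using H
  onBoundary H := by simpa using H
  conn H := by simpa using H
  isInf H := by simpa using H

theorem exists_sideCompatible_rot : ∃ π, SideCompatible (.r 1) π := by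
  have hp : ∀ {n : ℕ} (p : Pos n), (DihedralGroup.r 1 : DihedralGroup 4) • p = p.rot :=
    fun _ => rfl
  have ht : ∀ t : Tile, (DihedralGroup.r 1 : DihedralGroup 4) • t = t.rot := fun _ => rfl
  refine ⟨fun | .N => .E | .E => .S | .S => .W | .W => .N, ?_, ?_, ?_, ?_⟩
  · intro n s p q H
    rw [hp, hp]
    cases s <;> simp only [Pos.Nbr, Pos.rot, Fin.val_rev, Fin.ext_iff] at H ⊢ <;> omega
  · intro n s p H
    rw [hp]
    cases s <;> simp only [Pos.OnBoundary, Pos.rot, Fin.val_rev] at H ⊢ <;> omega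
  · intro s t H
    rw [ht]
    revert H
    rcases t with (_ | _ | _ | _ | _ | _ | _ | _ | _ | _ | _ | (_ | _ | _)) <;> cases s <;> decide
  · intro t H
    rw [ht]
    rcases t with (_ | _ | _ | _ | _ | _ | _ | _ | _ | _ | _ | (_ | _ | _)) <;> exact H

theorem exists_sideCompatible_flip : ∃ π, SideCompatible (.sr 0) π := by
  have hp : ∀ {n : ℕ} (p : Pos n), (DihedralGroup.sr 0 : DihedralGroup 4) • p = p.flip :=
    fun _ => rfl
  have ht : ∀ t : Tile, (DihedralGroup.sr 0 : DihedralGroup 4) • t = t.flip := fun _ => rfl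
  refine ⟨fun | .N => .W | .W => .N | .S => .E | .E => .S, ?_, ?_, ?_, ?_⟩
  · intro n s p q H
    rw [hp, hp]
    cases s <;> simpa only [Pos.Nbr, Pos.flip] using H
  · intro n s p H
    rw [hp]
    cases s <;> simpa only [Pos.OnBoundary, Pos.flip] using H
  · intro s t H
    rw [ht]
    revert H
    rcases t with (_ | _ | _ | _ | _ | _ | _ | _ | _ | _ | _ | (_ | _ | _)) <;> cases s <;> decide
  · intro t H
    rw [ht]
    rcases t with (_ | _ | _ | _ | _ | _ | _ | _ | _ | _ | _ | (_ | _ | _)) <;> exact H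

theorem exists_sideCompatible (g : DihedralGroup 4) : ∃ π, SideCompatible g π := by
  have hr : ∀ i : ZMod 4, ∃ π, SideCompatible (.r i) π := by
    obtain ⟨π, h1⟩ := exists_sideCompatible_rot
    have key : ∀ i : ZMod 4, i = 0 ∨ i = 1 ∨ i = 1 + 1 ∨ i = 1 + 1 + 1 := by decide
    intro i
    rcases key i with rfl | rfl | rfl | rfl
    · exact ⟨id, sideCompatible_one⟩
    · exact ⟨π, h1⟩
    · exact ⟨_, h1.mul h1⟩
    · exact ⟨_, (h1.mul h1).mul h1⟩
  obtain i | i := g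
  · exact hr i
  · obtain ⟨π, h1⟩ := exists_sideCompatible_flip
    obtain ⟨θ, h2⟩ := hr i
    have := h1.mul h2
    rw [DihedralGroup.sr_mul_r, zero_add] at this
    exact ⟨_, this⟩

namespace Mosaic

variable {n : ℕ}

theorem turn_mul (g h : DihedralGroup 4) (M : Mosaic n) :
    M.turn (g * h) = (M.turn h).turn g := by
  funext p
  simp only [turn, mul_smul, mul_inv_rev]

theorem isInf_turn {g : DihedralGroup 4} {M : Mosaic n} {p : Pos n} :
    (M.turn g p).IsInf ↔ (M (g⁻¹ • p)).IsInf := by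
  obtain ⟨π, hπ⟩ := exists_sideCompatible g
  obtain ⟨θ, hθ⟩ := exists_sideCompatible g⁻¹
  exact ⟨fun h => by simpa [turn] using hθ.isInf h, fun h => hπ.isInf h⟩

/-- The conditions on the `T_∞` tiles of a tangle mosaic. -/
structure Separated (M : Mosaic n) : Prop where
  not_nbr : ∀ s p q, Pos.Nbr s p q → (M p).IsInf → ¬ (M q).IsInf
  not_onBoundary : ∀ s p, Pos.OnBoundary s p → ¬ (M p).IsInf

theorem IsTangle.separated {M : Mosaic n} (h : M.IsTangle) : M.Separated where
  not_nbr s p q hpq hp hq := h.2.2.1 s p q hpq ⟨hp, hq⟩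
  not_onBoundary := h.2.2.2

theorem Separated.turn {M : Mosaic n} (h : M.Separated) (g : DihedralGroup 4) :
    (M.turn g).Separated := by
  obtain ⟨θ, hθ⟩ := exists_sideCompatible g⁻¹
  refine ⟨fun s p q hpq hp hq => ?_, fun s p hp hi => ?_⟩
  · rw [isInf_turn] at hp hq
    exact h.not_nbr _ _ _ (hθ.nbr hpq) hp hq
  · rw [isInf_turn] at hi
    exact h.not_onBoundary _ _ (hθ.onBoundary hp) hi

theorem subsingleton_boundaryPoints_turn {M : Mosaic n}
    (h : ∀ s, (M.boundaryPoints s).Subsingleton) (g : DihedralGroup 4) (s : Side) :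
    ((M.turn g).boundaryPoints s).Subsingleton := by
  obtain ⟨θ, hθ⟩ := exists_sideCompatible g⁻¹
  have key : ∀ p ∈ (M.turn g).boundaryPoints s, g⁻¹ • p ∈ M.boundaryPoints (θ s) := fun p hp =>
    ⟨hθ.onBoundary hp.1, by simpa [Mosaic.turn] using hθ.conn hp.2⟩
  intro p hp q hq
  exact smul_left_cancel _ (h _ (key p hp) (key q hq))

end Mosaic

/-! ### Cells of a mosaic -/

instance Side.instFinite : Finite Side :=
  Finite.of_surjective
    (fun i : Fin 4 => match i with | 0 => Side.N | 1 => .S | 2 => .E | 3 => .W)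
    (by rintro (_ | _ | _ | _); exacts [⟨0, rfl⟩, ⟨1, rfl⟩, ⟨2, rfl⟩, ⟨3, rfl⟩])

instance Pos.instFinite (n : ℕ) : Finite (Pos n) :=
  Finite.of_injective (fun p : Pos n => (p.row, p.col)) fun p q h => by
    rw [Prod.mk.injEq] at h
    exact Pos.ext h.1 h.2

namespace Pos

variable {n : ℕ}

@[simp] theorem corner_zero (p : Pos n) : p.corner 0 = (p.row : ℕ) := rfl
@[simp] theorem corner_one (p : Pos n) : p.corner 1 = (p.col : ℕ) := rfl
@[simp] theorem corner_two (p : Pos n) : p.corner 2 = 0 := rfl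

/-- The octahedron in the cube of the tile at `p` that contains the arcs of the tile. -/
def oct (p : Pos n) : Set E3 :=
  {y | |y 0 - ((p.row : ℕ) + 1/2)| + |y 1 - ((p.col : ℕ) + 1/2)| + 2 * |y 2 - 1/2| ≤ 1/2}

/-- The open vertical column over the square of the tile at `p`. -/
def openColumn (p : Pos n) : Set E3 :=
  {y | |y 0 - ((p.row : ℕ) + 1/2)| < 1/2 ∧ |y 1 - ((p.col : ℕ) + 1/2)| < 1/2}

/-- The cube of the tile at `p`, with neighbourhoods of its vertical edges cut off. -/
def cutCube (ε : ℝ) (p : Pos n) : Set E3 :=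
  {y | |y 0 - ((p.row : ℕ) + 1/2)| ≤ 1/2 ∧ |y 1 - ((p.col : ℕ) + 1/2)| ≤ 1/2 ∧
    |y 0 - ((p.row : ℕ) + 1/2)| + |y 1 - ((p.col : ℕ) + 1/2)| ≤ 1 - ε ∧ 0 ≤ y 2 ∧ y 2 ≤ 1}

/-- The cube of the tile at `p`, enlarged by `δ` on every side. -/
def box (δ : ℝ) (p : Pos n) : Set E3 :=
  {y | |y 0 - ((p.row : ℕ) + 1/2)| ≤ 1/2 + δ ∧ |y 1 - ((p.col : ℕ) + 1/2)| ≤ 1/2 + δ ∧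
    |y 2 - 1/2| ≤ 1/2 + δ}

theorem exists_nbr {p q : Pos n} (hne : p ≠ q)
    (h : |((p.row : ℕ) : ℝ) - (q.row : ℕ)| + |((p.col : ℕ) : ℝ) - (q.col : ℕ)| < 2) :
    ∃ s, Nbr s p q := by
  have h' : |((p.row : ℕ) : ℤ) - (q.row : ℕ)| + |((p.col : ℕ) : ℤ) - (q.col : ℕ)| < 2 := by
    exact_mod_cast h
  have hne' : ¬ ((p.row : ℕ) = q.row ∧ (p.col : ℕ) = q.col) := fun h =>
    hne (Pos.ext (Fin.ext h.1) (Fin.ext h.2))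
  have : ((q.row : ℕ) + 1 = p.row ∧ (q.col : ℕ) = p.col) ∨
      ((q.row : ℕ) = p.row + 1 ∧ (q.col : ℕ) = p.col) ∨
      ((q.col : ℕ) = p.col + 1 ∧ (q.row : ℕ) = p.row) ∨
      ((q.col : ℕ) + 1 = p.col ∧ (q.row : ℕ) = p.row) := by
    rcases abs_cases (((p.row : ℕ) : ℤ) - (q.row : ℕ)) with ⟨h1, h2⟩ | ⟨h1, h2⟩ <;>
    rcases abs_cases (((p.col : ℕ) : ℤ) - (q.col : ℕ)) with ⟨h3, h4⟩ | ⟨h3, h4⟩ <;> omega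
  rcases this with h | h | h | h
  · exact ⟨.N, h.1, Fin.ext h.2⟩
  · exact ⟨.S, h.1, Fin.ext h.2⟩
  · exact ⟨.E, h.1, Fin.ext h.2⟩
  · exact ⟨.W, h.1, Fin.ext h.2⟩

/-- The sum of the coordinates changes parity from a tile to its neighbours. -/
theorem Nbr.parity {s : Side} {p q : Pos n} (h : Nbr s p q) :
    ((p.row : ℕ) + p.col + q.row + q.col) % 2 = 1 := by
  cases s <;> simp only [Nbr, Fin.ext_iff] at h <;> omega

theorem Nbr.unique {s : Side} {p q r : Pos n} (h : Nbr s p q) (h' : Nbr s p r) : q = r := by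
  cases s <;> simp only [Nbr, Fin.ext_iff] at h h' <;>
    exact Pos.ext (Fin.ext (by omega)) (Fin.ext (by omega))

/-- Points over the squares of two tiles that are close to the centres bound the distance of the
tiles. -/
theorem exists_nbr_of_abs {p q : Pos n} (hne : p ≠ q) {y : E3} {a b : ℝ}
    (hp : |y 0 - ((p.row : ℕ) + 1/2)| + |y 1 - ((p.col : ℕ) + 1/2)| ≤ a)
    (hq : |y 0 - ((q.row : ℕ) + 1/2)| + |y 1 - ((q.col : ℕ) + 1/2)| ≤ b) (hab : a + b < 2) :
    ∃ s, Nbr s p q := by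
  refine exists_nbr hne ?_
  have h0 := abs_sub_le ((p.row : ℕ) + 1/2 : ℝ) (y 0) ((q.row : ℕ) + 1/2)
  have h1 := abs_sub_le ((p.col : ℕ) + 1/2 : ℝ) (y 1) ((q.col : ℕ) + 1/2)
  rw [abs_sub_comm _ (y 0), add_sub_add_right_eq_sub] at h0
  rw [abs_sub_comm _ (y 1), add_sub_add_right_eq_sub] at h1
  linarith

theorem exists_nbr_of_mem_oct {p q : Pos n} (hne : p ≠ q) {y : E3} (hp : y ∈ p.oct)
    (hq : y ∈ q.oct) : ∃ s, Nbr s p q := by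
  simp only [oct, Set.mem_ofPred_eq] at hp hq
  have h2 := abs_nonneg (y 2 - 1/2)
  exact exists_nbr_of_abs hne (y := y) (a := 1/2) (b := 1/2) (by linarith) (by linarith)
    (by norm_num)

/-- The closed square of a tile does not meet the open square of another tile. -/
theorem eq_of_mem_openColumn {p q : Pos n} {y : E3} (h0 : |y 0 - ((p.row : ℕ) + 1/2)| ≤ 1/2)
    (h1 : |y 1 - ((p.col : ℕ) + 1/2)| ≤ 1/2) (hq : y ∈ q.openColumn) : p = q := by
  have key : ∀ {a b : ℕ} {t : ℝ}, |t - (a + 1/2)| ≤ 1/2 → |t - (b + 1/2)| < 1/2 → a = b := by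
    intro a b t ha hb
    rw [abs_le] at ha
    rw [abs_lt] at hb
    have h1 : (a : ℝ) < b + 1 := by linarith
    have h2 : (b : ℝ) < a + 1 := by linarith
    norm_cast at h1 h2
    omega
  exact Pos.ext (Fin.ext (key h0 hq.1)) (Fin.ext (key h1 hq.2))

theorem abs_le_of_mem_oct {p : Pos n} {y : E3} (hy : y ∈ p.oct) :
    |y 0 - ((p.row : ℕ) + 1/2)| ≤ 1/2 ∧ |y 1 - ((p.col : ℕ) + 1/2)| ≤ 1/2 ∧ |y 2 - 1/2| ≤ 1/4 := by
  simp only [oct, Set.mem_ofPred_eq] at hy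
  have h0 := abs_nonneg (y 0 - ((p.row : ℕ) + 1/2))
  have h1 := abs_nonneg (y 1 - ((p.col : ℕ) + 1/2))
  have h2 := abs_nonneg (y 2 - 1/2)
  exact ⟨by linarith, by linarith, by linarith⟩

theorem notMem_openColumn_of_nbr {s : Side} {p q : Pos n} (h : Nbr s p q) {y : E3}
    (hy : y ∈ q.oct) : y ∉ p.openColumn := fun hp => by
  obtain ⟨h0, h1, -⟩ := abs_le_of_mem_oct hy
  have := eq_of_mem_openColumn h0 h1 hp
  subst this
  have := h.parity
  omega

theorem convex_abs (i : Fin 3) (c : ℝ) : ConvexOn ℝ Set.univ fun y : E3 => |y i - c| :=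
  ⟨convex_univ, fun x _ y _ a b ha hb hab => by
    simpa using abs_convexComb_sub_le ha hb hab (x i) (y i) c⟩

theorem convex_box (δ : ℝ) (p : Pos n) : Convex ℝ (p.box δ) := by
  have h (i : Fin 3) (c : ℝ) : Convex ℝ {y : E3 | |y i - c| ≤ 1/2 + δ} := by
    simpa using (convex_abs i c).convex_le (1/2 + δ)
  exact (h 0 _).inter ((h 1 _).inter (h 2 _))

theorem convex_cutCube (ε : ℝ) (p : Pos n) : Convex ℝ (p.cutCube ε) := by
  have h (i : Fin 3) (c : ℝ) : Convex ℝ {y : E3 | |y i - c| ≤ 1/2} := by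
    simpa using (convex_abs i c).convex_le (1/2)
  have h' (c d r : ℝ) : Convex ℝ {y : E3 | |y 0 - c| + |y 1 - d| ≤ r} := by
    simpa using ((convex_abs 0 c).add (convex_abs 1 d)).convex_le r
  have h2 : Convex ℝ {y : E3 | 0 ≤ y 2 ∧ y 2 ≤ 1} := by
    intro x hx y hy a b ha hb hab
    simp only [Set.mem_ofPred_eq, PiLp.add_apply, PiLp.smul_apply, smul_eq_mul] at *
    exact ⟨add_nonneg (mul_nonneg ha hx.1) (mul_nonneg hb hy.1), by nlinarith⟩
  exact (h 0 _).inter ((h 1 _).inter ((h' _ _ _).inter h2))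

theorem isClosed_box (δ : ℝ) (p : Pos n) : IsClosed (p.box δ) := by
  have h (i : Fin 3) (c : ℝ) : IsClosed {y : E3 | |y i - c| ≤ 1/2 + δ} :=
    isClosed_le (by fun_prop) continuous_const
  exact (h 0 _).inter ((h 1 _).inter (h 2 _))

/-- The interior of an enlarged cube contains the points that satisfy the strict inequalities. -/
theorem mem_interior_box {δ : ℝ} {p : Pos n} {y : E3}
    (h0 : |y 0 - ((p.row : ℕ) + 1/2)| < 1/2 + δ) (h1 : |y 1 - ((p.col : ℕ) + 1/2)| < 1/2 + δ)
    (h2 : |y 2 - 1/2| < 1/2 + δ) : y ∈ interior (p.box δ) := by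
  have h (i : Fin 3) (c : ℝ) : IsOpen {y : E3 | |y i - c| < 1/2 + δ} :=
    isOpen_lt (by fun_prop) continuous_const
  refine interior_maximal (s := p.box δ) ?_ ((h 0 ((p.row : ℕ) + 1/2)).inter
    ((h 1 ((p.col : ℕ) + 1/2)).inter (h 2 (1/2)))) ⟨h0, h1, h2⟩
  exact fun z hz => ⟨hz.1.le, hz.2.1.le, hz.2.2.le⟩

theorem cutCube_subset_interior_box {δ ε : ℝ} (hδ : 0 < δ) (p : Pos n) :
    p.cutCube ε ⊆ interior (p.box δ) := fun y hy => by
  refine mem_interior_box (hy.1.trans_lt (by linarith)) (hy.2.1.trans_lt (by linarith)) ?_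
  rw [abs_lt]
  exact ⟨by linarith [hy.2.2.2.1], by linarith [hy.2.2.2.2]⟩

/-- The distance of two points of an enlarged cube is bounded. -/
theorem dist_le_of_mem_box {δ : ℝ} (hδ : δ ≤ 1/2) {p : Pos n} {y z : E3} (hy : y ∈ p.box δ)
    (hz : z ∈ p.box δ) : dist y z ≤ 6 := by
  have key : ∀ {a b c : ℝ}, |a - c| ≤ 1/2 + δ → |b - c| ≤ 1/2 + δ → (a - b) ^ 2 ≤ 4 := by
    intro a b c ha hb
    rw [abs_le] at ha hb
    nlinarith
  rw [EuclideanSpace.dist_eq, Real.sqrt_le_left (by norm_num), Fin.sum_univ_three]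
  simp only [Real.dist_eq, sq_abs]
  linarith [key hy.1 hz.1, key hy.2.1 hz.2.1, key hy.2.2 hz.2.2]

theorem isCompact_box {δ : ℝ} (hδ : δ ≤ 1/2) (p : Pos n) : IsCompact (p.box δ) :=
  Metric.isCompact_of_isClosed_isBounded (isClosed_box δ p)
    (Metric.isBounded_iff.2 ⟨6, fun _ hy _ hz => dist_le_of_mem_box hδ hy hz⟩)

end Pos

/-- The interior of the square column over an `n`-mosaic. -/
def openSquare (n : ℕ) : Set E3 := {y | 0 < y 0 ∧ y 0 < n ∧ 0 < y 1 ∧ y 1 < n}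

/-- The closed slab of an `n`-mosaic, with neighbourhoods of its vertical edges cut off. -/
def cutSlab (n : ℕ) : Set E3 :=
  {y | |y 0 - n/2| ≤ n/2 ∧ |y 1 - n/2| ≤ n/2 ∧ |y 0 - n/2| + |y 1 - n/2| ≤ n - 1/2 ∧
    0 ≤ y 2 ∧ y 2 ≤ 1}

namespace Pos

variable {n : ℕ}

theorem oct_subset_cutSlab (p : Pos n) : p.oct ⊆ cutSlab n := by
  intro y hy
  obtain ⟨h0, h1, h2⟩ := abs_le_of_mem_oct hy
  have h2' := abs_le.1 h2
  simp only [oct, Set.mem_ofPred_eq] at hy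
  have key : ∀ (a : Fin n) , |((a : ℕ) + 1/2 : ℝ) - n/2| ≤ n/2 - 1/2 := fun a => by
    have h : ((a : ℕ) + 1 : ℝ) ≤ n := by exact_mod_cast a.2
    have h' : (0 : ℝ) ≤ (a : ℕ) := Nat.cast_nonneg _
    rw [abs_le]
    constructor <;> linarith
  have k0 := key p.row
  have k1 := key p.col
  have t0 := abs_sub_le (y 0) ((p.row : ℕ) + 1/2) (n/2)
  have t1 := abs_sub_le (y 1) ((p.col : ℕ) + 1/2) (n/2)
  have h3 := abs_nonneg (y 2 - 1/2)
  exact ⟨by linarith, by linarith, by linarith, by linarith, by linarith⟩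

/-- The position does not lie along the boundary. -/
def Inner (p : Pos n) : Prop := ∀ s, ¬ OnBoundary s p

theorem Inner.bounds {p : Pos n} (hp : p.Inner) :
    (1 : ℝ) ≤ (p.row : ℕ) ∧ ((p.row : ℕ) : ℝ) + 2 ≤ n ∧
      (1 : ℝ) ≤ (p.col : ℕ) ∧ ((p.col : ℕ) : ℝ) + 2 ≤ n := by
  have hN := hp .N
  have hS := hp .S
  have hE := hp .E
  have hW := hp .W
  simp only [OnBoundary] at hN hS hE hW
  have h1 := p.row.2
  have h2 := p.col.2
  refine ⟨?_, ?_, ?_, ?_⟩ <;> norm_cast <;> omega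

theorem Inner.box_subset {p : Pos n} (hp : p.Inner) {δ : ℝ} (hδ : δ < 1) :
    p.box δ ⊆ openSquare n := by
  intro y hy
  obtain ⟨b1, b2, b3, b4⟩ := hp.bounds
  have h0 := abs_le.1 hy.1
  have h1 := abs_le.1 hy.2.1
  exact ⟨by linarith, by linarith, by linarith, by linarith⟩

theorem Inner.cutCube_subset {p : Pos n} (hp : p.Inner) {ε : ℝ} :
    p.cutCube ε ⊆ cutSlab n ∩ openSquare n := by
  intro y hy
  refine ⟨?_, hp.box_subset (δ := 1/2) (by norm_num)
    (interior_subset (cutCube_subset_interior_box (by norm_num) p hy))⟩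
  obtain ⟨b1, b2, b3, b4⟩ := hp.bounds
  obtain ⟨h0, h1, -, h3, h4⟩ := hy
  have key : ∀ {t a : ℝ}, |t - (a + 1/2)| ≤ 1/2 → 1 ≤ a → a + 2 ≤ n → |t - n/2| ≤ n/2 - 1 := by
    intro t a ht h1 h2
    rw [abs_le] at ht ⊢
    constructor <;> linarith
  have k0 := key h0 b1 b2
  have k1 := key h1 b3 b4
  exact ⟨by linarith, by linarith, by linarith, h3, h4⟩

/-- The octahedron of a tile meets the boundary of the square in centres of faces only. -/
theorem eq_of_mem_oct_of_notMem_openSquare {p : Pos n} {y : E3} (hy : y ∈ p.oct)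
    (hs : y ∉ openSquare n) : ∃ s, OnBoundary s p ∧ y = p.corner + faceCenter s := by
  obtain ⟨h0, h1, h2⟩ := abs_le_of_mem_oct hy
  have h0' := abs_le.1 h0
  have h1' := abs_le.1 h1
  simp only [oct, Set.mem_ofPred_eq] at hy
  have g2 := abs_nonneg (y 2 - 1/2)
  have g1 := abs_nonneg (y 1 - ((p.col : ℕ) + 1/2))
  have g0 := abs_nonneg (y 0 - ((p.row : ℕ) + 1/2))
  have r0 : (0 : ℝ) ≤ (p.row : ℕ) := Nat.cast_nonneg _
  have c0 : (0 : ℝ) ≤ (p.col : ℕ) := Nat.cast_nonneg _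
  have rn : ((p.row : ℕ) + 1 : ℝ) ≤ n := by exact_mod_cast p.row.2
  have cn : ((p.col : ℕ) + 1 : ℝ) ≤ n := by exact_mod_cast p.col.2
  have zero : ∀ {t : ℝ}, |t| ≤ 0 → t = 0 := fun h => abs_eq_zero.1 (le_antisymm h (abs_nonneg _))
  have a0 := neg_abs_le (y 0 - ((p.row : ℕ) + 1/2))
  have a1 := le_abs_self (y 0 - ((p.row : ℕ) + 1/2))
  have a2 := neg_abs_le (y 1 - ((p.col : ℕ) + 1/2))
  have a3 := le_abs_self (y 1 - ((p.col : ℕ) + 1/2))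
  have hcase : y 0 ≤ 0 ∨ n ≤ y 0 ∨ y 1 ≤ 0 ∨ n ≤ y 1 := by
    by_contra! h
    exact hs ⟨h.1, h.2.1, h.2.2.1, h.2.2.2⟩
  rcases hcase with h | h | h | h
  · have e1 := zero (show |y 1 - ((p.col : ℕ) + 1/2)| ≤ 0 by linarith)
    have e2 := zero (show |y 2 - 1/2| ≤ 0 by linarith)
    have e0 : ((p.row : ℕ) : ℝ) = 0 := by linarith
    refine ⟨.N, by exact_mod_cast e0, ?_⟩
    ext i; fin_cases i <;> simp [faceCenter] <;> linarith
  · have e1 := zero (show |y 1 - ((p.col : ℕ) + 1/2)| ≤ 0 by linarith)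
    have e2 := zero (show |y 2 - 1/2| ≤ 0 by linarith)
    have e0 : ((p.row : ℕ) : ℝ) + 1 = n := by linarith
    refine ⟨.S, by simp only [OnBoundary]; exact_mod_cast e0, ?_⟩
    ext i; fin_cases i <;> simp [faceCenter] <;> linarith
  · have e1 := zero (show |y 0 - ((p.row : ℕ) + 1/2)| ≤ 0 by linarith)
    have e2 := zero (show |y 2 - 1/2| ≤ 0 by linarith)
    have e0 : ((p.col : ℕ) : ℝ) = 0 := by linarith
    refine ⟨.W, by exact_mod_cast e0, ?_⟩
    ext i; fin_cases i <;> simp [faceCenter] <;> linarith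
  · have e1 := zero (show |y 0 - ((p.row : ℕ) + 1/2)| ≤ 0 by linarith)
    have e2 := zero (show |y 2 - 1/2| ≤ 0 by linarith)
    have e0 : ((p.col : ℕ) : ℝ) + 1 = n := by linarith
    refine ⟨.E, by simp only [OnBoundary]; exact_mod_cast e0, ?_⟩
    ext i; fin_cases i <;> simp [faceCenter] <;> linarith

theorem openColumn_subset (p : Pos n) : p.openColumn ⊆ openSquare n := by
  intro y hy
  have h0 := abs_lt.1 hy.1
  have h1 := abs_lt.1 hy.2
  have r0 : (0 : ℝ) ≤ (p.row : ℕ) := Nat.cast_nonneg _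
  have c0 : (0 : ℝ) ≤ (p.col : ℕ) := Nat.cast_nonneg _
  have rn : ((p.row : ℕ) + 1 : ℝ) ≤ n := by exact_mod_cast p.row.2
  have cn : ((p.col : ℕ) + 1 : ℝ) ≤ n := by exact_mod_cast p.col.2
  exact ⟨by linarith, by linarith, by linarith, by linarith⟩

/-- The common face of two adjacent tiles lies in the interior of the square. -/
theorem Nbr.mem_openSquare {s : Side} {p q : Pos n} (h : Nbr s p q) {y : E3} (hp : y ∈ p.oct)
    (hq : y ∈ q.oct) : y ∈ openSquare n := by
  have r0 : (0 : ℝ) ≤ (p.row : ℕ) := Nat.cast_nonneg _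
  have c0 : (0 : ℝ) ≤ (p.col : ℕ) := Nat.cast_nonneg _
  have rn : ((p.row : ℕ) + 1 : ℝ) ≤ n := by exact_mod_cast p.row.2
  have cn : ((p.col : ℕ) + 1 : ℝ) ≤ n := by exact_mod_cast p.col.2
  have r0' : (0 : ℝ) ≤ (q.row : ℕ) := Nat.cast_nonneg _
  have c0' : (0 : ℝ) ≤ (q.col : ℕ) := Nat.cast_nonneg _
  have rn' : ((q.row : ℕ) + 1 : ℝ) ≤ n := by exact_mod_cast q.row.2
  have cn' : ((q.col : ℕ) + 1 : ℝ) ≤ n := by exact_mod_cast q.col.2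
  simp only [oct, Set.mem_ofPred_eq] at hp hq
  have p0 := neg_abs_le (y 0 - ((p.row : ℕ) + 1/2))
  have p1 := le_abs_self (y 0 - ((p.row : ℕ) + 1/2))
  have p2 := neg_abs_le (y 1 - ((p.col : ℕ) + 1/2))
  have p3 := le_abs_self (y 1 - ((p.col : ℕ) + 1/2))
  have q0 := neg_abs_le (y 0 - ((q.row : ℕ) + 1/2))
  have q1 := le_abs_self (y 0 - ((q.row : ℕ) + 1/2))
  have q2 := neg_abs_le (y 1 - ((q.col : ℕ) + 1/2))
  have q3 := le_abs_self (y 1 - ((q.col : ℕ) + 1/2))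
  have p4 := abs_nonneg (y 2 - 1/2)
  have hcast : (((q.row : ℕ) + 1 : ℝ) = (p.row : ℕ) ∧ ((q.col : ℕ) : ℝ) = (p.col : ℕ)) ∨
      (((q.row : ℕ) : ℝ) = (p.row : ℕ) + 1 ∧ ((q.col : ℕ) : ℝ) = (p.col : ℕ)) ∨
      (((q.col : ℕ) : ℝ) = (p.col : ℕ) + 1 ∧ ((q.row : ℕ) : ℝ) = (p.row : ℕ)) ∨
      (((q.col : ℕ) + 1 : ℝ) = (p.col : ℕ) ∧ ((q.row : ℕ) : ℝ) = (p.row : ℕ)) := by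
    cases s <;> simp only [Nbr, Fin.ext_iff] at h <;> norm_cast <;> tauto
  rcases hcast with ⟨e1, e2⟩ | ⟨e1, e2⟩ | ⟨e1, e2⟩ | ⟨e1, e2⟩ <;>
    exact ⟨by linarith, by linarith, by linarith, by linarith⟩

end Pos

/-! ### A single mosaic -/

namespace Mosaic

variable {n : ℕ} (M : Mosaic n)

/-- The arcs of the tile at `p`, placed in the cube of the tile. -/
noncomputable def cellArcs (p : Pos n) : Set E3 := (fun x => p.corner + x) '' (M p).arcs

variable {M}

theorem mem_cellArcs {p : Pos n} {y : E3} : y ∈ M.cellArcs p ↔ y - p.corner ∈ (M p).arcs := by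
  constructor
  · rintro ⟨x, hx, rfl⟩
    simpa using hx
  · exact fun h => ⟨_, h, by simp⟩

theorem cellArcs_subset_oct (p : Pos n) : M.cellArcs p ⊆ p.oct := by
  rintro _ ⟨x, hx, rfl⟩
  have := (M p).arcs_subset_tileOct hx
  simp only [tileOct, Set.mem_ofPred_eq] at this
  simp only [Pos.oct, Set.mem_ofPred_eq, PiLp.add_apply, Pos.corner_zero, Pos.corner_one,
    Pos.corner_two, add_sub_add_left_eq_sub, zero_add]
  exact this

theorem not_isInf_of_mem_cellArcs {p : Pos n} {y : E3} (hy : y ∈ M.cellArcs p) :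
    ¬ (M p).IsInf := by
  rw [mem_cellArcs] at hy
  intro h
  cases hp : M p <;> rw [hp] at hy h
  case Tinf => exact hy
  all_goals exact h

theorem isClosed_cellArcs (p : Pos n) : IsClosed (M.cellArcs p) :=
  (Homeomorph.addLeft p.corner).isClosedMap _ (M p).isClosed_arcs

theorem isClosed_tame : IsClosed M.tame :=
  isClosed_iUnion_of_finite isClosed_cellArcs

theorem exists_of_mem_tame {y : E3} (hy : y ∈ M.tame) : ∃ p, y ∈ M.cellArcs p :=
  Set.mem_iUnion.1 hy

theorem tame_subset_cutSlab : M.tame ⊆ cutSlab n :=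
  Set.iUnion_subset fun p => (cellArcs_subset_oct p).trans p.oct_subset_cutSlab

theorem branchLE_cellArcs_of_arcs {p : Pos n} {y : E3} {m : ℕ∞}
    (h : BranchLE (M p).arcs (y - p.corner) m) : BranchLE (M.cellArcs p) y m := by
  have := h.image_homothety one_pos p.corner
  simpa only [cellArcs, one_smul, add_comm _ p.corner, add_sub_cancel] using this

theorem branchLE_cellArcs_four (p : Pos n) (y : E3) : BranchLE (M.cellArcs p) y 4 :=
  branchLE_cellArcs_of_arcs (BranchLE.arcs _ _)

/-- A point of the cube of a tile outside of the open column has at most two branches in the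
tile. -/
theorem branchLE_cellArcs_two {p : Pos n} {y : E3} (hy : y ∉ p.openColumn) :
    BranchLE (M.cellArcs p) y 2 := by
  refine branchLE_cellArcs_of_arcs ?_
  have hcase : 1/2 ≤ |y 0 - ((p.row : ℕ) + 1/2)| ∨ 1/2 ≤ |y 1 - ((p.col : ℕ) + 1/2)| := by
    by_contra! h
    exact hy h
  rw [le_abs, le_abs] at hcase
  rcases hcase with (h | h) | (h | h)
  · refine BranchLE.arcs_of_sideDepth_lt _ .S ?_
    simp [sideDepth]
    linarith
  · refine BranchLE.arcs_of_sideDepth_lt _ .N ?_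
    simp [sideDepth]
    linarith
  · refine BranchLE.arcs_of_sideDepth_lt _ .E ?_
    simp [sideDepth]
    linarith
  · refine BranchLE.arcs_of_sideDepth_lt _ .W ?_
    simp [sideDepth]
    linarith

/-- The arcs of a mosaic have at most two branches at a point that belongs to the octahedron of a
single tile and lies outside of the open column of the tile. -/
theorem branchLE_tame_two {y : E3} (hsub : ∀ p q : Pos n, y ∈ p.oct → y ∈ q.oct → p = q)
    (hoff : ∀ p : Pos n, y ∈ p.oct → y ∉ p.openColumn) : BranchLE M.tame y 2 :=
  BranchLE.iUnion_of_subsingleton isClosed_cellArcs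
    (fun p q hp hq => hsub p q (cellArcs_subset_oct p hp) (cellArcs_subset_oct q hq))
    fun p hp => branchLE_cellArcs_two (hoff p (cellArcs_subset_oct p hp))

/-- The arcs of a mosaic have at most four branches at every point: a point lies in the cubes of at
most two tiles that have an arc through it, and if there are two, it is the centre of a face. -/
theorem branchLE_tame_four (y : E3) : BranchLE M.tame y 4 := by
  by_cases h : ∃ p q : Pos n, p ≠ q ∧ y ∈ p.oct ∧ y ∈ q.oct
  · obtain ⟨p, q, hne, hp, hq⟩ := h
    obtain ⟨s, hs⟩ := Pos.exists_nbr_of_mem_oct hne hp hq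
    obtain ⟨t, ht⟩ := Pos.exists_nbr_of_mem_oct hne.symm hq hp
    -- three pairwise adjacent tiles are excluded by parity
    have hthird : ∀ r : Pos n, y ∈ r.oct → r = p ∨ r = q := by
      intro r hr
      by_contra! hrn
      obtain ⟨s₁, h1⟩ := Pos.exists_nbr_of_mem_oct hrn.1 hr hp
      obtain ⟨s₂, h2⟩ := Pos.exists_nbr_of_mem_oct hrn.2 hr hq
      have := hs.parity
      have := h1.parity
      have := h2.parity
      omega
    have hcl : IsClosed (⋃ r : {r : Pos n // r ≠ p ∧ r ≠ q}, M.cellArcs r) :=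
      isClosed_iUnion_of_finite fun r => isClosed_cellArcs _
    have hout : y ∉ ⋃ r : {r : Pos n // r ≠ p ∧ r ≠ q}, M.cellArcs r := by
      rintro hy
      obtain ⟨r, hr⟩ := Set.mem_iUnion.1 hy
      rcases hthird r (cellArcs_subset_oct _ hr) with h | h
      exacts [r.2.1 h, r.2.2 h]
    have h2p : BranchLE (M.cellArcs p) y 2 :=
      branchLE_cellArcs_two (Pos.notMem_openColumn_of_nbr hs hq)
    have h2q : BranchLE (M.cellArcs q) y 2 :=
      branchLE_cellArcs_two (Pos.notMem_openColumn_of_nbr ht hp)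
    refine ((h2p.union h2q).union (BranchLE.of_notMem hcl hout)).mono ?_ (by norm_num)
    refine Set.iUnion_subset fun r z hz => ?_
    by_cases hrp : r = p
    · exact Or.inl (Or.inl (hrp ▸ hz))
    by_cases hrq : r = q
    · exact Or.inl (Or.inr (hrq ▸ hz))
    · exact Or.inr (Set.mem_iUnion.2 ⟨⟨r, hrp, hrq⟩, hz⟩)
  · push Not at h
    refine BranchLE.iUnion_of_subsingleton isClosed_cellArcs (fun p q hp hq => ?_)
      fun p _ => branchLE_cellArcs_four p y
    by_contra hne
    exact h p q hne (cellArcs_subset_oct p hp) (cellArcs_subset_oct q hq)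

/-- On the boundary of the square, the arcs of a mosaic have at most two branches, and they are at
height `1/2`. -/
theorem branchLE_tame_two_of_notMem_openSquare {y : E3} (hy : y ∉ openSquare n) :
    BranchLE M.tame y 2 := by
  refine branchLE_tame_two (fun p q hp hq => ?_) fun p hp hp' => hy (p.openColumn_subset hp')
  by_contra hne
  obtain ⟨s, hs⟩ := Pos.exists_nbr_of_mem_oct hne hp hq
  exact hy (hs.mem_openSquare hp hq)

theorem height_of_mem_tame_of_notMem_openSquare {y : E3} (hy : y ∈ M.tame)
    (hs : y ∉ openSquare n) : y 2 = 1/2 := by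
  obtain ⟨p, hp⟩ := exists_of_mem_tame hy
  obtain ⟨s, -, rfl⟩ := Pos.eq_of_mem_oct_of_notMem_openSquare (cellArcs_subset_oct p hp) hs
  cases s <;> simp [faceCenter]

end Mosaic

/-- A mosaic with sets `C i` and `D i` inserted into the cubes of some of its `T_∞` tiles, the
positions of which are numbered by `ι`. The sets `D i` stand for inserted mosaics (with everything
that is inserted into them), and the sets `C i` for connecting segments, which lie on the
boundary of the column of the tile. -/
structure InsertedMosaic {n : ℕ} (M : Mosaic n) {ι : Type*} (pos : ι → Pos n) (C D : ι → Set E3)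
    (ε : ℝ) : Prop where
  separated : M.Separated
  injective : Function.Injective pos
  isInf : ∀ i, (M (pos i)).IsInf
  isClosed_C : ∀ i, IsClosed (C i)
  isClosed_D : ∀ i, IsClosed (D i)
  eps_pos : 0 < ε
  C_subset : ∀ i, C i ⊆ (pos i).cutCube ε
  D_subset : ∀ i, D i ⊆ (pos i).cutCube ε
  notMem_of_mem_C : ∀ i, ∀ y ∈ C i, y ∉ (pos i).openColumn
  branch_C : ∀ i, ∀ y ∈ C i, BranchLE (C i) y 2

namespace InsertedMosaic

variable {n : ℕ} {M : Mosaic n} {ι : Type*} {pos : ι → Pos n} {C D : ι → Set E3} {ε : ℝ}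
  (H : InsertedMosaic M pos C D ε)
include H

theorem inner (i : ι) : (pos i).Inner := fun s hs => H.separated.not_onBoundary s _ hs (H.isInf i)

theorem subset_cutCube (i : ι) : C i ∪ D i ⊆ (pos i).cutCube ε :=
  Set.union_subset (H.C_subset i) (H.D_subset i)

theorem isClosed (i : ι) : IsClosed (C i ∪ D i) := (H.isClosed_C i).union (H.isClosed_D i)

/-- The sets that are inserted into different tiles are disjoint. -/
theorem eq_of_mem {i j : ι} {y : E3} (hi : y ∈ C i ∪ D i) (hj : y ∈ C j ∪ D j) : i = j := by
  by_contra hne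
  have hi' := H.subset_cutCube i hi
  have hj' := H.subset_cutCube j hj
  obtain ⟨s, hs⟩ := Pos.exists_nbr_of_abs (fun h => hne (H.injective h)) hi'.2.2.1 hj'.2.2.1
    (by linarith [H.eps_pos])
  exact H.separated.not_nbr s _ _ hs (H.isInf i) (H.isInf j)

theorem mem_D_of_mem_openColumn {i : ι} {y : E3} (hy : y ∈ M.tame ∪ ⋃ j, (C j ∪ D j))
    (hi : y ∈ (pos i).openColumn) : y ∈ D i := by
  rcases hy with hy | hy
  · obtain ⟨p, hp⟩ := Mosaic.exists_of_mem_tame hy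
    obtain ⟨h0, h1, -⟩ := Pos.abs_le_of_mem_oct (Mosaic.cellArcs_subset_oct p hp)
    obtain rfl := Pos.eq_of_mem_openColumn h0 h1 hi
    exact absurd (H.isInf i) (Mosaic.not_isInf_of_mem_cellArcs hp)
  · obtain ⟨j, hj⟩ := Set.mem_iUnion.1 hy
    have hj' := H.subset_cutCube j hj
    obtain rfl := H.injective (Pos.eq_of_mem_openColumn hj'.1 hj'.2.1 hi)
    exact hj.resolve_left fun h => H.notMem_of_mem_C _ y h hi

/-- The arcs of the mosaic meet the cube of a `T_∞` tile, away from the vertical edges, in the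
centres of faces only, and have at most two branches there. -/
theorem tame_of_mem {i : ι} {y : E3} (hi : y ∈ C i ∪ D i) :
    BranchLE M.tame y 2 ∧ (y ∈ M.tame → y 2 = 1/2) := by
  have hi' := H.subset_cutCube i hi
  have hnbr : ∀ p : Pos n, p ≠ pos i → y ∈ p.oct → ∃ s, Pos.Nbr s (pos i) p := by
    intro p hp hy
    simp only [Pos.oct, Set.mem_ofPred_eq] at hy
    exact Pos.exists_nbr_of_abs hp.symm (b := 1/2) hi'.2.2.1
      (by linarith [abs_nonneg (y 2 - 1/2)]) (by linarith [H.eps_pos])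
  have hne : ∀ p, y ∈ M.cellArcs p → p ≠ pos i := by
    rintro p hp rfl
    exact Mosaic.not_isInf_of_mem_cellArcs hp (H.isInf i)
  -- the point lies on a face of each other cube that contains it
  have hface : ∀ p : Pos n, p ≠ pos i → y ∉ p.openColumn := fun p hp hy =>
    hp (Pos.eq_of_mem_openColumn hi'.1 hi'.2.1 hy).symm
  refine ⟨BranchLE.iUnion_of_subsingleton Mosaic.isClosed_cellArcs (fun p q hp hq => ?_)
    fun p hp => Mosaic.branchLE_cellArcs_two (hface p (hne p hp)), fun hy => ?_⟩
  · by_contra hpq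
    have hp' := Mosaic.cellArcs_subset_oct p hp
    have hq' := Mosaic.cellArcs_subset_oct q hq
    obtain ⟨s₁, h1⟩ := hnbr p (hne p hp) hp'
    obtain ⟨s₂, h2⟩ := hnbr q (hne q hq) hq'
    obtain ⟨s₃, h3⟩ := Pos.exists_nbr_of_mem_oct hpq hp' hq'
    have := h1.parity
    have := h2.parity
    have := h3.parity
    omega
  · obtain ⟨p, hp⟩ := Mosaic.exists_of_mem_tame hy
    have ho := hface p (hne p hp)
    have hp' := Mosaic.cellArcs_subset_oct p hp
    simp only [Pos.oct, Pos.openColumn, Set.mem_ofPred_eq, not_and_or, not_lt] at hp' ho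
    have h0 := abs_nonneg (y 0 - ((p.row : ℕ) + 1/2))
    have h1 := abs_nonneg (y 1 - ((p.col : ℕ) + 1/2))
    have h2 := abs_nonneg (y 2 - 1/2)
    have : |y 2 - 1/2| = 0 := by rcases ho with ho | ho <;> linarith
    linarith [abs_eq_zero.1 this]

/-- If a point does not lie in the open columns of the inserted mosaics through it, then there are
at most four branches at the point. It is assumed that on the boundary of its column an inserted
mosaic has at most two branches and is not as high as the centre of a face. -/
theorem branchLE_four [Finite ι] {y : E3}
    (hD2 : ∀ i, y ∈ D i → y ∉ (pos i).openColumn → BranchLE (D i) y 2 ∧ y 2 < 1/2)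
    (hy : ∀ i, y ∈ D i → y ∉ (pos i).openColumn) :
    BranchLE (M.tame ∪ ⋃ i, (C i ∪ D i)) y 4 := by
  by_cases hex : ∃ i, y ∈ C i ∪ D i
  · obtain ⟨i, hi⟩ := hex
    have ho : y ∉ (pos i).openColumn := hi.elim (H.notMem_of_mem_C i y) (hy i)
    obtain ⟨ht, hth⟩ := H.tame_of_mem hi
    have hCi : BranchLE (C i) y 2 := by
      by_cases hC : y ∈ C i
      · exact H.branch_C i y hC
      · exact (BranchLE.of_notMem (H.isClosed_C i) hC).mono subset_rfl (by norm_num)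
    have hrest : BranchLE (⋃ j : {j // j ≠ i}, (C j ∪ D j)) y 0 := by
      refine BranchLE.of_notMem (isClosed_iUnion_of_finite fun j => H.isClosed _) fun h => ?_
      obtain ⟨j, hj⟩ := Set.mem_iUnion.1 h
      exact j.2 (H.eq_of_mem hj hi)
    -- the inserted mosaic and the arcs around it do not meet at the same height
    have htD : BranchLE (M.tame ∪ D i) y 2 := by
      by_cases hD : y ∈ D i
      · have hyt : y ∉ M.tame := fun h => (hD2 i hD ho).2.ne (hth h)
        exact ((BranchLE.of_notMem Mosaic.isClosed_tame hyt).union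
          (hD2 i hD ho).1).mono subset_rfl (by norm_num)
      · exact (ht.union (BranchLE.of_notMem (H.isClosed_D i) hD)).mono subset_rfl (by norm_num)
    refine ((htD.union hCi).union hrest).mono ?_ (by norm_num)
    rintro z (hz | hz)
    · exact Or.inl (Or.inl (Or.inl hz))
    · obtain ⟨j, hj⟩ := Set.mem_iUnion.1 hz
      by_cases hji : j = i
      · subst hji
        exact hj.elim (fun h => Or.inl (Or.inr h)) fun h => Or.inl (Or.inl (Or.inr h))
      · exact Or.inr (Set.mem_iUnion.2 ⟨⟨j, hji⟩, hj⟩)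
  · have hcl : IsClosed (⋃ i, (C i ∪ D i)) := isClosed_iUnion_of_finite H.isClosed
    exact ((Mosaic.branchLE_tame_four y).union
      (BranchLE.of_notMem hcl (by simpa using hex))).mono subset_rfl (by norm_num)

/-- On the boundary of the square there are at most two branches, and they are at height `1/2`. -/
theorem branchLE_two_of_notMem_openSquare [Finite ι] {y : E3}
    (hy : y ∈ M.tame ∪ ⋃ i, (C i ∪ D i)) (hs : y ∉ openSquare n) :
    BranchLE (M.tame ∪ ⋃ i, (C i ∪ D i)) y 2 ∧ y 2 = 1/2 := by
  have hout : y ∉ ⋃ i, (C i ∪ D i) := fun h => by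
    obtain ⟨i, hi⟩ := Set.mem_iUnion.1 h
    exact hs ((H.inner i).cutCube_subset (H.subset_cutCube i hi)).2
  have hcl : IsClosed (⋃ i, (C i ∪ D i)) := isClosed_iUnion_of_finite H.isClosed
  exact ⟨((Mosaic.branchLE_tame_two_of_notMem_openSquare hs).union
    (BranchLE.of_notMem hcl hout)).mono subset_rfl (by norm_num),
    Mosaic.height_of_mem_tame_of_notMem_openSquare (hy.resolve_right hout) hs⟩

/-- The boundary of a slightly enlarged cube of a `T_∞` tile meets everything in at most four
points: the arcs of each of the four adjacent tiles contribute at most one point, and nothing else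
comes near the cube. -/
theorem encard_inter_frontier_box_le (i : ι) {δ : ℝ} (hδ : 0 < δ) (hδ4 : δ < 1/4)
    (hδε : 2 * δ < ε) :
    ((M.tame ∪ ⋃ j, (C j ∪ D j)) ∩ frontier ((pos i).box δ)).encard ≤ 4 := by
  set q := pos i with hq
  have hrel : ∀ y ∈ (M.tame ∪ ⋃ j, (C j ∪ D j)) ∩ frontier (q.box δ), ∃ s p, Pos.Nbr s q p ∧
      y - p.corner ∈ (M p).arcs ∧ sideDepth s.opp (y - p.corner) = δ := by
    rintro y ⟨hy, hfr⟩
    rw [(Pos.isClosed_box δ q).frontier_eq] at hfr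
    obtain ⟨hbox, hint⟩ := hfr
    have hbox' : |y 0 - ((q.row : ℕ) + 1/2)| + |y 1 - ((q.col : ℕ) + 1/2)| ≤ 1 + 2 * δ := by
      linarith [hbox.1, hbox.2.1]
    rcases hy with hy | hy
    · obtain ⟨p, hp⟩ := Mosaic.exists_of_mem_tame hy
      have hne : q ≠ p := by
        rintro rfl
        exact Mosaic.not_isInf_of_mem_cellArcs hp (H.isInf i)
      have hoct := Mosaic.cellArcs_subset_oct p hp
      have hsum := hoct
      simp only [Pos.oct, Set.mem_ofPred_eq] at hsum
      have h2 := abs_nonneg (y 2 - 1/2)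
      obtain ⟨s, hs⟩ := Pos.exists_nbr_of_abs hne (b := 1/2) hbox' (by linarith) (by linarith)
      refine ⟨s, p, hs, Mosaic.mem_cellArcs.1 hp, ?_⟩
      obtain ⟨a0, a1, a2⟩ := Pos.abs_le_of_mem_oct hoct
      have hcase : 1/2 + δ ≤ |y 0 - ((q.row : ℕ) + 1/2)| ∨
          1/2 + δ ≤ |y 1 - ((q.col : ℕ) + 1/2)| := by
        by_contra! h
        exact hint (Pos.mem_interior_box h.1 h.2 (by linarith))
      rw [abs_le] at a0 a1
      have b0 := abs_le.1 hbox.1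
      have b1 := abs_le.1 hbox.2.1
      rw [le_abs, le_abs] at hcase
      cases s <;> simp only [Pos.Nbr, Fin.ext_iff] at hs <;> obtain ⟨e1, e2⟩ := hs <;>
        simp only [Side.opp, sideDepth, PiLp.sub_apply, Pos.corner_zero, Pos.corner_one]
      · have e1' : ((p.row : ℕ) : ℝ) + 1 = (q.row : ℕ) := by exact_mod_cast e1
        have e2' : ((p.col : ℕ) : ℝ) = (q.col : ℕ) := by exact_mod_cast e2
        rcases hcase with (h | h) | (h | h) <;> linarith
      · have e1' : ((p.row : ℕ) : ℝ) = (q.row : ℕ) + 1 := by exact_mod_cast e1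
        have e2' : ((p.col : ℕ) : ℝ) = (q.col : ℕ) := by exact_mod_cast e2
        rcases hcase with (h | h) | (h | h) <;> linarith
      · have e1' : ((p.col : ℕ) : ℝ) = (q.col : ℕ) + 1 := by exact_mod_cast e1
        have e2' : ((p.row : ℕ) : ℝ) = (q.row : ℕ) := by exact_mod_cast e2
        rcases hcase with (h | h) | (h | h) <;> linarith
      · have e1' : ((p.col : ℕ) : ℝ) + 1 = (q.col : ℕ) := by exact_mod_cast e1
        have e2' : ((p.row : ℕ) : ℝ) = (q.row : ℕ) := by exact_mod_cast e2
        rcases hcase with (h | h) | (h | h) <;> linarith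
    · exfalso
      obtain ⟨j, hj⟩ := Set.mem_iUnion.1 hy
      have hj' := H.subset_cutCube j hj
      by_cases hji : j = i
      · subst hji
        exact hint (Pos.cutCube_subset_interior_box hδ _ hj')
      · obtain ⟨s, hs⟩ := Pos.exists_nbr_of_abs (fun h => hji (H.injective h)) hj'.2.2.1 hbox'
          (by linarith)
        exact H.separated.not_nbr s _ _ hs (H.isInf j) (H.isInf i)
  have : Nonempty Side := ⟨.N⟩
  have : Nonempty (Pos n) := ⟨q⟩
  choose! f g hfg using hrel
  have hinj : Set.InjOn f ((M.tame ∪ ⋃ j, (C j ∪ D j)) ∩ frontier (q.box δ)) := by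
    intro y hy z hz hyz
    obtain ⟨y1, y2, y3⟩ := hfg y hy
    obtain ⟨z1, z2, z3⟩ := hfg z hz
    rw [← hyz] at z1 z3
    have hg := y1.unique z1
    rw [← hg] at z2 z3
    have h1 := (M (g y)).eq_of_mem_arcs (f y).opp y2 (by linarith)
    have h2 := (M (g y)).eq_of_mem_arcs (f y).opp z2 (by linarith)
    rw [y3] at h1
    rw [z3, ← h1] at h2
    exact (sub_left_injective h2).symm
  have hcard : (Set.univ : Set Side).encard ≤ 4 := by
    have : (Set.univ : Set Side) ⊆ {.N, .S, .E, .W} := fun s _ => by cases s <;> simp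
    refine (Set.encard_le_encard this).trans ?_
    refine (Set.encard_insert_le _ _).trans ?_
    have h3 : ({.S, .E, .W} : Set Side).encard ≤ 3 := by
      refine (Set.encard_insert_le _ _).trans ?_
      have h2 : ({.E, .W} : Set Side).encard ≤ 2 :=
        (Set.encard_insert_le _ _).trans (by rw [Set.encard_singleton]; norm_num)
      exact (add_le_add_left h2 1).trans (by norm_num)
    exact (add_le_add_left h3 1).trans (by norm_num)
  exact (Set.encard_le_encard_of_injOn (fun _ _ => Set.mem_univ _) hinj).trans hcard

end InsertedMosaic

/-! ### The tree -/

namespace RootedTree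

variable {T : RootedTree.{u}}

theorem exists_covBy_le {u w : T} (h : u < w) : ∃ c, u ⋖ c ∧ c ≤ w := by
  obtain ⟨k, hk⟩ := h.le.exists_pred_iterate
  induction k generalizing w with
  | zero => exact absurd hk.symm h.ne
  | succ k ih =>
    rw [Function.iterate_succ_apply] at hk
    by_cases hp : Order.pred w = u
    · refine ⟨w, ?_, le_rfl⟩
      rw [← hp]
      exact Order.pred_covBy_of_not_isMin fun hm => (hm.not_lt h)
    · have hlt : u < Order.pred w :=
        lt_of_le_of_ne (hk ▸ Order.pred_iterate_le k (Order.pred w)) (Ne.symm hp)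
      obtain ⟨c, hc, hcw⟩ := ih hlt hk
      exact ⟨c, hc, hcw.trans (Order.pred_le w)⟩

/-- Induction along the path from a vertex to one of its descendants. -/
theorem le_induction {P : T → Prop} {u v : T} (huv : u ≤ v) (hu : P u)
    (hstep : ∀ a b : T, u ≤ a → a ⋖ b → P a → P b) : P v := by
  obtain ⟨k, hk⟩ := huv.exists_pred_iterate
  induction k generalizing v with
  | zero =>
    obtain rfl : v = u := hk
    exact hu
  | succ k ih =>
    by_cases hv : IsMin v
    · rwa [← hv.eq_of_le huv]
    rw [Function.iterate_succ_apply] at hk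
    have hle : u ≤ Order.pred v := hk ▸ Order.pred_iterate_le k (Order.pred v)
    exact hstep _ _ hle (Order.pred_covBy_of_not_isMin hv) (ih hle hk)

theorem bot_induction {P : T → Prop} (hbot : P ⊥) (hstep : ∀ a b : T, a ⋖ b → P a → P b) (v : T) :
    P v :=
  le_induction (bot_le (a := v)) hbot fun a b _ => hstep a b

end RootedTree

/-! ### Frames -/

namespace TreeMosaic

theorem depth_eq_of_covBy (M : TreeMosaic.{u}) {u w : M.tree} (h : u ⋖ w) :
    M.depth w = M.depth u + 1 := by
  have hpred : Order.pred w = u := h.pred_eq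
  have hu : Order.pred^[M.depth u] u = ⊥ :=
    Nat.sInf_mem (s := {k | Order.pred^[k] u = ⊥}) (bot_le (a := u)).exists_pred_iterate
  have hw : Order.pred^[M.depth w] w = ⊥ :=
    Nat.sInf_mem (s := {k | Order.pred^[k] w = ⊥}) (bot_le (a := w)).exists_pred_iterate
  refine le_antisymm (Nat.sInf_le ?_) ?_
  · simp only [Set.mem_ofPred_eq, Function.iterate_succ_apply, hpred, hu]
  · obtain ⟨d, hd⟩ : ∃ d, M.depth w = d + 1 := by
      refine Nat.exists_eq_succ_of_ne_zero fun h0 => ?_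
      rw [h0] at hw
      exact (bot_le.trans_lt h.lt).ne' hw
    rw [hd, Function.iterate_succ_apply, hpred] at hw
    rw [hd]
    exact Nat.succ_le_succ (Nat.sInf_le hw)

theorem frame_bot (M : TreeMosaic.{u}) : M.frame ⊥ = ⟨1, 0, 1⟩ := by
  have : M.depth ⊥ = 0 := Nat.le_zero.1 (Nat.sInf_le rfl)
  rw [frame, this, frameAux]

theorem frame_of_covBy (M : TreeMosaic.{u}) {u w : M.tree} (h : u ⋖ w) :
    M.frame w = M.childFrame (M.frame u) h := by
  rw [frame, M.depth_eq_of_covBy h, frameAux, dif_neg (bot_le.trans_lt h.lt).ne']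
  obtain rfl : Order.pred w = u := h.pred_eq
  rfl

theorem Frame.map_eq (f : Frame) : f.map = fun x => f.scale • x + f.position := rfl

/-- The homothety of a frame. -/
noncomputable def Frame.homeomorph (f : Frame) (hf : f.scale ≠ 0) : E3 ≃ₜ E3 :=
  (Homeomorph.smulOfNeZero f.scale hf).trans (Homeomorph.addRight f.position)

@[simp] theorem Frame.coe_homeomorph (f : Frame) (hf : f.scale ≠ 0) :
    ⇑(f.homeomorph hf) = f.map := rfl

theorem Frame.image_segment (f : Frame) (a b : E3) :
    f.map '' segment ℝ a b = segment ℝ (f.map a) (f.map b) := by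
  have := _root_.image_segment ℝ ((f.scale • (LinearMap.id : E3 →ₗ[ℝ] E3)).toAffineMap +
    AffineMap.const ℝ E3 f.position) a b
  exact this

variable (M : TreeMosaic.{u})

/-- The position in the placed mosaic of `u` of the tile that is targeted by an edge. -/
noncomputable def target {u w : M.tree} (h : u ⋖ w) : Pos (M.dim u) :=
  (M.frame u).orient • (M.emb h).pos

/-- The homothety that inserts the mosaic of `w` into the cube of the targeted tile. -/
noncomputable def insert {u w : M.tree} (h : u ⋖ w) (z : E3) : E3 :=
  ((M.dim w : ℝ))⁻¹ • z + (M.target h).corner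

theorem frame_map_insert {u w : M.tree} (h : u ⋖ w) (z : E3) :
    (M.frame u).map (M.insert h z) = (M.frame w).map z := by
  rw [M.frame_of_covBy h]
  simp only [Frame.map, childFrame, insert, target, smul_add, smul_smul, div_eq_mul_inv,
    add_assoc]

theorem placed_of_covBy {u w : M.tree} (h : u ⋖ w) :
    M.placed w = ((M.F w).turn (M.emb h).orient).turn (M.frame u).orient := by
  rw [placed, M.frame_of_covBy h, ← Mosaic.turn_mul]
  rfl

/-- The part of the realization that comes from the vertex `v` itself and the edges to its
children. -/
noncomputable def own (v : M.tree) : Set E3 :=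
  (M.frame v).map '' (M.placed v).tame ∪ ⋃ w : {w : M.tree // v ⋖ w}, M.connecting w.2

/-- The part of the realization that comes from the subtree rooted at `v`. -/
noncomputable def below (v : M.tree) : Set E3 := closure (⋃ w : Set.Ici v, M.own w)

theorem realization_eq_below_bot : M.realization = M.below ⊥ := by
  refine congrArg closure (Set.Subset.antisymm ?_ ?_)
  · refine Set.union_subset (Set.iUnion_subset fun v => ?_)
      (Set.iUnion_subset fun u => Set.iUnion_subset fun w => Set.iUnion_subset fun h => ?_)
    · exact Set.subset_union_left.trans
        (Set.subset_iUnion (fun w : Set.Ici (⊥ : M.tree) => M.own w) ⟨v, bot_le⟩)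
    · refine Set.Subset.trans ?_
        (Set.subset_iUnion (fun w : Set.Ici (⊥ : M.tree) => M.own w) ⟨u, bot_le⟩)
      exact (Set.subset_iUnion (fun w : {w : M.tree // u ⋖ w} => M.connecting w.2) ⟨w, h⟩).trans
        Set.subset_union_right
  · refine Set.iUnion_subset fun v => Set.union_subset_union
      (Set.subset_iUnion (fun v => (M.frame v).map '' (M.placed v).tame) v.1) ?_
    refine Set.iUnion_subset fun w => ?_
    exact Set.subset_iUnion_of_subset v.1 (Set.subset_iUnion_of_subset w.1
      (Set.subset_iUnion_of_subset w.2 subset_rfl))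

/-- The connecting segments of an edge, in the coordinates of the parent. -/
noncomputable def localConnecting {u w : M.tree} (h : u ⋖ w) : Set E3 :=
  ⋃ (s : Side) (p ∈ (M.placed w).boundaryPoints s),
    segment ℝ ((M.target h).corner + faceCenter s) (M.insert h (p.corner + faceCenter s))

theorem connecting_eq {u w : M.tree} (h : u ⋖ w) :
    M.connecting h = (M.frame u).map '' M.localConnecting h := by
  simp only [localConnecting, Set.image_iUnion, Frame.image_segment, frame_map_insert]
  rfl

theorem isClosed_localConnecting {u w : M.tree} (h : u ⋖ w) : IsClosed (M.localConnecting h) := by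
  exact isClosed_iUnion_of_finite fun s => (Set.toFinite _).isClosed_biUnion fun p _ =>
    isClosed_segment _ _

/-- The part of the realization that comes from the subtree rooted at `v`, in the coordinates
of `v`. -/
noncomputable def localBelow (v : M.tree) : Set E3 := (M.frame v).map ⁻¹' M.below v

end TreeMosaic

/-! ### Scales and inserted mosaics -/

namespace TreeMosaic

variable {M : TreeMosaic.{u}}

theorem three_le_dim (hS : M.SuitablyConnected) {u w : M.tree} (h : u ⋖ w) :
    (3 : ℝ) ≤ M.dim w := by
  exact_mod_cast (hS.2.1 w (bot_le.trans_lt h.lt).ne').2.2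

theorem scale_of_covBy {u w : M.tree} (h : u ⋖ w) :
    (M.frame w).scale = (M.frame u).scale / M.dim w := by
  rw [M.frame_of_covBy h]
  rfl

theorem scale_pos (hS : M.SuitablyConnected) (v : M.tree) : 0 < (M.frame v).scale := by
  induction v using RootedTree.bot_induction with
  | hbot => rw [frame_bot]; exact one_pos
  | hstep u w h ih =>
    rw [scale_of_covBy h]
    exact div_pos ih (by linarith [three_le_dim hS h])

theorem separated_placed (hS : M.SuitablyConnected) (v : M.tree) : (M.placed v).Separated := by
  refine Mosaic.Separated.turn (Mosaic.IsTangle.separated ?_) _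
  by_cases hv : v = ⊥
  · subst hv
    exact hS.1.1
  · exact (hS.2.1 v hv).1

theorem isInf_target (hW : M.WellDefined) {u w : M.tree} (h : u ⋖ w) :
    (M.placed u (M.target h)).IsInf := by
  rw [placed, Mosaic.isInf_turn, target, inv_smul_smul]
  exact (hW u).mapsTo (Set.mem_univ (⟨w, h⟩ : {w : M.tree // u ⋖ w}))

theorem injective_target (hW : M.WellDefined) (u : M.tree) :
    Function.Injective fun w : {w : M.tree // u ⋖ w} => M.target w.2 := fun w w' h =>
  (hW u).injOn (Set.mem_univ w) (Set.mem_univ w') (smul_left_cancel _ h)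

theorem subsingleton_boundaryPoints (hS : M.SuitablyConnected) {u w : M.tree} (h : u ⋖ w)
    (s : Side) : ((M.placed w).boundaryPoints s).Subsingleton := by
  rw [M.placed_of_covBy h]
  refine Mosaic.subsingleton_boundaryPoints_turn (fun s => ?_) _ s
  rw [← Set.encard_le_one_iff_subsingleton, ← (Set.toFinite _).cast_ncard_eq,
    hS.2.2 u w h s]
  split_ifs <;> simp

/-- Insertion carries the slab of a mosaic into the cube of the targeted tile. -/
theorem insert_mem_cutCube (hS : M.SuitablyConnected) {u w : M.tree} (h : u ⋖ w) {z : E3}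
    (hz : z ∈ cutSlab (M.dim w)) : M.insert h z ∈ (M.target h).cutCube (1 / (2 * M.dim w)) := by
  have hd : (0 : ℝ) < M.dim w := by linarith [three_le_dim hS h]
  have key : ∀ t a : ℝ, |(M.dim w : ℝ)⁻¹ * t + a - (a + 1/2)| =
      (M.dim w : ℝ)⁻¹ * |t - M.dim w / 2| := fun t a => by
    rw [← abs_of_pos (inv_pos.2 hd), ← abs_mul, abs_of_pos (inv_pos.2 hd)]
    congr 1
    field_simp
    ring
  obtain ⟨h0, h1, h2, h3, h4⟩ := hz
  simp only [Pos.cutCube, insert, Set.mem_ofPred_eq, PiLp.add_apply, PiLp.smul_apply, smul_eq_mul,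
    Pos.corner_zero, Pos.corner_one, Pos.corner_two, key, ← mul_add, add_zero]
  simp only [inv_mul_le_iff₀ hd]
  refine ⟨by linarith, by linarith, ?_, mul_nonneg (inv_nonneg.2 hd.le) h3, ?_⟩
  · refine h2.trans (le_of_eq ?_)
    field_simp
  · linarith [three_le_dim hS h]

theorem insert_mem_openColumn_iff (hS : M.SuitablyConnected) {u w : M.tree} (h : u ⋖ w) {z : E3} :
    M.insert h z ∈ (M.target h).openColumn ↔ z ∈ openSquare (M.dim w) := by
  have hd : (0 : ℝ) < M.dim w := by linarith [three_le_dim hS h]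
  have key : ∀ t a : ℝ, |(M.dim w : ℝ)⁻¹ * t + a - (a + 1/2)| < 1/2 ↔ 0 < t ∧ t < M.dim w := by
    intro t a
    have e : t = M.dim w * ((M.dim w : ℝ)⁻¹ * t) := by field_simp
    generalize (M.dim w : ℝ)⁻¹ * t = τ at e ⊢
    rw [e, abs_lt, mul_pos_iff_of_pos_left hd]
    constructor
    · rintro ⟨h1, h2⟩
      exact ⟨by linarith, by nlinarith⟩
    · rintro ⟨h1, h2⟩
      have : τ < 1 := by nlinarith
      exact ⟨by linarith, by linarith⟩
  simp only [Pos.openColumn, openSquare, insert, Set.mem_ofPred_eq, PiLp.add_apply,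
    PiLp.smul_apply, smul_eq_mul, Pos.corner_zero, Pos.corner_one, key]
  tauto

theorem faceCenter_mem_cutCube {n : ℕ} (p : Pos n) (s : Side) {ε : ℝ} (hε : ε ≤ 1/2) :
    p.corner + faceCenter s ∈ p.cutCube ε := by
  cases s <;> simp [Pos.cutCube, faceCenter] <;> norm_num <;> linarith

theorem faceCenter_mem_oct {n : ℕ} (p : Pos n) (s : Side) : p.corner + faceCenter s ∈ p.oct := by
  cases s <;> simp [Pos.oct, faceCenter] <;> norm_num

theorem localConnecting_subset_cutCube (hS : M.SuitablyConnected) {u w : M.tree} (h : u ⋖ w) :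
    M.localConnecting h ⊆ (M.target h).cutCube (1 / (2 * M.dim w)) := by
  have hd := three_le_dim hS h
  refine Set.iUnion_subset fun s => Set.iUnion₂_subset fun p _ => ?_
  refine (Pos.convex_cutCube _ _).segment_subset (faceCenter_mem_cutCube _ s ?_)
    (insert_mem_cutCube hS h (p.oct_subset_cutSlab (faceCenter_mem_oct p s)))
  rw [div_le_div_iff₀ (by linarith) (by norm_num)]
  linarith

/-- The plane of a vertical face of the cube of a tile. -/
def facePlane {n : ℕ} (p : Pos n) (s : Side) : Set E3 := {y | sideDepth s (y - p.corner) = 0}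

theorem connecting_segment_subset_facePlane (hS : M.SuitablyConnected) {u w : M.tree} (h : u ⋖ w)
    {s : Side} {p : Pos (M.dim w)} (hp : Pos.OnBoundary s p) :
    segment ℝ ((M.target h).corner + faceCenter s) (M.insert h (p.corner + faceCenter s)) ⊆
      facePlane (M.target h) s := by
  have hd : (M.dim w : ℝ) ≠ 0 := by linarith [three_le_dim hS h]
  intro y hy
  obtain ⟨t, -, -, ht⟩ := exists_coord_of_mem_segment hy
  have h0 := ht 0
  have h1 := ht 1
  cases s <;> simp only [Pos.OnBoundary] at hp <;>
    simp [insert, faceCenter, facePlane, sideDepth, hp] at h0 h1 ⊢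
  · linarith
  · have : ((p.row : ℕ) : ℝ) + 1 = M.dim w := by exact_mod_cast hp
    have e : (M.dim w : ℝ)⁻¹ * (p.row : ℕ) + (M.dim w : ℝ)⁻¹ = 1 := by
      rw [← mul_add_one, this, inv_mul_cancel₀ hd]
    rw [e] at h0
    linarith
  · have : ((p.col : ℕ) : ℝ) + 1 = M.dim w := by exact_mod_cast hp
    have e : (M.dim w : ℝ)⁻¹ * (p.col : ℕ) + (M.dim w : ℝ)⁻¹ = 1 := by
      rw [← mul_add_one, this, inv_mul_cancel₀ hd]
    rw [e] at h1
    linarith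
  · linarith

theorem notMem_openColumn_of_mem_facePlane {n : ℕ} {p : Pos n} {s : Side} {y : E3}
    (hy : y ∈ facePlane p s) : y ∉ p.openColumn := by
  rintro ⟨h0, h1⟩
  rw [abs_lt] at h0 h1
  cases s <;> simp [facePlane, sideDepth] at hy <;> linarith

/-- Away from the vertical edges, the faces of a cube are disjoint. -/
theorem eq_of_mem_facePlane {n : ℕ} {p : Pos n} {s t : Side} {ε : ℝ} (hε : 0 < ε) {y : E3}
    (hy : y ∈ p.cutCube ε) (hs : y ∈ facePlane p s) (ht : y ∈ facePlane p t) : s = t := by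
  obtain ⟨-, -, h, -, -⟩ := hy
  have a0 := neg_abs_le (y 0 - ((p.row : ℕ) + 1/2))
  have a1 := le_abs_self (y 0 - ((p.row : ℕ) + 1/2))
  have a2 := neg_abs_le (y 1 - ((p.col : ℕ) + 1/2))
  have a3 := le_abs_self (y 1 - ((p.col : ℕ) + 1/2))
  cases s <;> cases t <;> first
    | rfl
    | (exfalso
       simp [facePlane, sideDepth] at hs ht
       linarith)

/-- The connecting segments of an edge run on different faces of the cube of the targeted tile, and
there is at most one on each face. -/
theorem branchLE_localConnecting (hS : M.SuitablyConnected) {u w : M.tree} (h : u ⋖ w) {y : E3}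
    (hy : y ∈ M.localConnecting h) : BranchLE (M.localConnecting h) y 2 := by
  have hε : (0 : ℝ) < 1 / (2 * M.dim w) := by
    have := three_le_dim hS h
    positivity
  have hcube := localConnecting_subset_cutCube hS h hy
  have hplane : ∀ s, (⋃ p ∈ (M.placed w).boundaryPoints s, segment ℝ
      ((M.target h).corner + faceCenter s) (M.insert h (p.corner + faceCenter s))) ⊆
        facePlane (M.target h) s := fun s =>
    Set.iUnion₂_subset fun p hp => connecting_segment_subset_facePlane hS h hp.1
  refine BranchLE.iUnion_of_subsingleton
    (fun s => (Set.toFinite _).isClosed_biUnion fun p _ => isClosed_segment _ _)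
    (fun s t hs ht => eq_of_mem_facePlane hε hcube (hplane s hs) (hplane t ht)) fun s hs => ?_
  obtain ⟨p, hp, -⟩ := Set.mem_iUnion₂.1 hs
  refine (BranchLE.segment ((M.target h).corner + faceCenter s)
    (M.insert h (p.corner + faceCenter s))).mono ?_ le_rfl
  refine Set.iUnion₂_subset fun q hq => ?_
  rw [subsingleton_boundaryPoints hS h s hq hp]

theorem image_cutSlab_subset (hW : M.WellDefined) (hS : M.SuitablyConnected) {u v : M.tree}
    (huv : u ≤ v) :
    (M.frame v).map '' cutSlab (M.dim v) ⊆ (M.frame u).map '' cutSlab (M.dim u) := by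
  refine RootedTree.le_induction
    (P := fun v => (M.frame v).map '' cutSlab (M.dim v) ⊆ (M.frame u).map '' cutSlab (M.dim u))
    huv subset_rfl fun a b _ hab ih => Set.Subset.trans ?_ ih
  rintro _ ⟨z, hz, rfl⟩
  have hin : (M.target hab).Inner := fun s hs =>
    (separated_placed hS a).not_onBoundary s _ hs (isInf_target hW hab)
  exact ⟨_, (hin.cutCube_subset (insert_mem_cutCube hS hab hz)).1, M.frame_map_insert hab z⟩

theorem isClosed_cutSlab (n : ℕ) : IsClosed (cutSlab n) := by
  have h (i : Fin 3) (c r : ℝ) : IsClosed {y : E3 | |y i - c| ≤ r} :=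
    isClosed_le (by fun_prop) continuous_const
  have h' (c d r : ℝ) : IsClosed {y : E3 | |y 0 - c| + |y 1 - d| ≤ r} :=
    isClosed_le (by fun_prop) continuous_const
  have h2 : IsClosed {y : E3 | 0 ≤ y 2} := isClosed_le continuous_const (by fun_prop)
  have h3 : IsClosed {y : E3 | y 2 ≤ 1} := isClosed_le (by fun_prop) continuous_const
  exact (h 0 _ _).inter ((h 1 _ _).inter ((h' _ _ _).inter (h2.inter h3)))

/-- The part of the realization in the subtree of `v`, in the coordinates of `v`, lies in the slab
of the mosaic of `v` and avoids the vertical edges. -/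
theorem localBelow_subset_cutSlab (hW : M.WellDefined) (hS : M.SuitablyConnected) (v : M.tree) :
    M.localBelow v ⊆ cutSlab (M.dim v) := by
  have hv := (scale_pos hS v).ne'
  have hcl : IsClosed ((M.frame v).map '' cutSlab (M.dim v)) :=
    ((M.frame v).homeomorph hv).isClosedMap _ (isClosed_cutSlab _)
  have hsub : M.below v ⊆ (M.frame v).map '' cutSlab (M.dim v) := by
    refine closure_minimal (Set.iUnion_subset fun w => ?_) hcl
    refine Set.Subset.trans ?_ (image_cutSlab_subset hW hS w.2)
    refine Set.union_subset (Set.image_mono Mosaic.tame_subset_cutSlab)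
      (Set.iUnion_subset fun c => ?_)
    rw [connecting_eq]
    refine Set.image_mono ((localConnecting_subset_cutCube hS c.2).trans fun y hy => ?_)
    have hin : (M.target c.2).Inner := fun s hs =>
      (separated_placed hS w.1).not_onBoundary s _ hs (isInf_target hW c.2)
    exact (hin.cutCube_subset hy).1
  intro y hy
  obtain ⟨z, hz, hzy⟩ := hsub hy
  obtain rfl := ((M.frame v).homeomorph hv).injective hzy
  exact hz

instance finite_children (v : M.tree) : Finite {w : M.tree // v ⋖ w} :=
  (M.locallyFinite v).to_subtype

theorem isClosed_own (hS : M.SuitablyConnected) (v : M.tree) : IsClosed (M.own v) := by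
  have hcl := ((M.frame v).homeomorph (scale_pos hS v).ne').isClosedMap
  refine (hcl _ Mosaic.isClosed_tame).union (isClosed_iUnion_of_finite fun w => ?_)
  rw [connecting_eq]
  exact hcl _ (M.isClosed_localConnecting w.2)

theorem below_eq (hS : M.SuitablyConnected) (v : M.tree) :
    M.below v = M.own v ∪ ⋃ w : {w : M.tree // v ⋖ w}, M.below w := by
  have h : ⋃ w : Set.Ici v, M.own w =
      M.own v ∪ ⋃ w : {w : M.tree // v ⋖ w}, ⋃ x : Set.Ici w.1, M.own x := by
    refine Set.Subset.antisymm (Set.iUnion_subset fun x => ?_)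
      (Set.union_subset ?_ (Set.iUnion_subset fun w => Set.iUnion_subset fun x => ?_))
    · rcases x.2.eq_or_lt with hx | hx
      · exact hx ▸ Set.subset_union_left
      · obtain ⟨c, hc, hcx⟩ := RootedTree.exists_covBy_le hx
        refine Set.subset_union_of_subset_right ?_ _
        exact Set.subset_iUnion_of_subset ⟨c, hc⟩
          (Set.subset_iUnion (fun x : Set.Ici c => M.own x) ⟨x, hcx⟩)
    · exact Set.subset_iUnion (fun x : Set.Ici v => M.own x) ⟨v, le_rfl⟩
    · exact Set.subset_iUnion (fun x : Set.Ici v => M.own x) ⟨x, w.2.le.trans x.2⟩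
  rw [below, h, closure_union, (isClosed_own hS v).closure_eq, closure_iUnion_of_finite]
  rfl

theorem localBelow_eq (hS : M.SuitablyConnected) (v : M.tree) :
    M.localBelow v = (M.placed v).tame ∪ ⋃ w : {w : M.tree // v ⋖ w},
      (M.localConnecting w.2 ∪ M.insert w.2 '' M.localBelow w) := by
  have hinj : Function.Injective (M.frame v).map :=
    ((M.frame v).homeomorph (scale_pos hS v).ne').injective
  have hD : ∀ w : {w : M.tree // v ⋖ w},
      (M.frame v).map ⁻¹' M.below w = M.insert w.2 '' M.localBelow w := by
    intro w
    ext y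
    constructor
    · intro hy
      obtain ⟨z, hz⟩ := ((M.frame w).homeomorph (scale_pos hS w).ne').surjective ((M.frame v).map y)
      rw [Frame.coe_homeomorph] at hz
      refine ⟨z, ?_, hinj ?_⟩
      · rw [localBelow, Set.mem_preimage, hz]
        exact hy
      · rw [frame_map_insert, hz]
    · rintro ⟨z, hz, rfl⟩
      rw [Set.mem_preimage, frame_map_insert]
      exact hz
  rw [localBelow, below_eq hS v, own]
  simp only [Set.preimage_union, Set.preimage_iUnion, connecting_eq,
    Set.preimage_image_eq _ hinj, hD, Set.iUnion_union_distrib, Set.union_assoc]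

theorem isClosed_localBelow (v : M.tree) : IsClosed (M.localBelow v) :=
  isClosed_closure.preimage ((continuous_const_smul _).add continuous_const)

/-- Every vertex carries a mosaic into whose `T_∞` tiles its subtrees are inserted. -/
theorem exists_insertedMosaic (hW : M.WellDefined) (hS : M.SuitablyConnected) (v : M.tree) :
    ∃ ε, InsertedMosaic (M.placed v) (fun w : {w : M.tree // v ⋖ w} => M.target w.2)
      (fun w => M.localConnecting w.2) (fun w => M.insert w.2 '' M.localBelow w) ε := by
  obtain ⟨N, hN⟩ := (Set.finite_range fun w : {w : M.tree // v ⋖ w} => M.dim w).bddAbove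
  have hε : ∀ w : {w : M.tree // v ⋖ w}, (1 / (2 * (N + 1)) : ℝ) ≤ 1 / (2 * M.dim w) := by
    intro w
    have h3 := three_le_dim hS w.2
    have : (M.dim w : ℝ) ≤ N := by exact_mod_cast hN ⟨w, rfl⟩
    exact one_div_le_one_div_of_le (by linarith) (by linarith)
  have hmono : ∀ w : {w : M.tree // v ⋖ w}, (M.target w.2).cutCube (1 / (2 * M.dim w)) ⊆
      (M.target w.2).cutCube (1 / (2 * (N + 1)) : ℝ) := fun w y hy =>
    ⟨hy.1, hy.2.1, hy.2.2.1.trans (by linarith [hε w]), hy.2.2.2⟩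
  refine ⟨1 / (2 * (N + 1)), separated_placed hS v, injective_target hW v,
    fun w => isInf_target hW w.2, fun w => M.isClosed_localConnecting w.2, fun w => ?_,
    by positivity, fun w => (localConnecting_subset_cutCube hS w.2).trans (hmono w), fun w => ?_,
    fun w y hy => ?_, fun w y hy => branchLE_localConnecting hS w.2 hy⟩
  · have hd : ((M.dim w : ℝ))⁻¹ ≠ 0 := inv_ne_zero (by linarith [three_le_dim hS w.2])
    exact ((Homeomorph.smulOfNeZero _ hd).trans (Homeomorph.addRight _)).isClosedMap _
      (isClosed_localBelow w.1)
  · rintro _ ⟨z, hz, rfl⟩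
    exact hmono w (insert_mem_cutCube hS w.2 (localBelow_subset_cutSlab hW hS w hz))
  · obtain ⟨s, hs⟩ := Set.mem_iUnion.1 hy
    obtain ⟨p, hp, hps⟩ := Set.mem_iUnion₂.1 hs
    exact notMem_openColumn_of_mem_facePlane
      (connecting_segment_subset_facePlane hS w.2 hp.1 hps)

theorem branchLE_localBelow_two (hW : M.WellDefined) (hS : M.SuitablyConnected) {v : M.tree}
    {z : E3} (hz : z ∈ M.localBelow v) (ho : z ∉ openSquare (M.dim v)) :
    BranchLE (M.localBelow v) z 2 ∧ z 2 = 1/2 := by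
  obtain ⟨ε, H⟩ := exists_insertedMosaic hW hS v
  rw [localBelow_eq hS v] at hz ⊢
  exact H.branchLE_two_of_notMem_openSquare hz ho

/-! ### Small balls around the points of the realization -/

/-- Over the interior of the square of `v`, the realization consists of the subtree of `v` only. -/
theorem realization_inter_subset_below (hW : M.WellDefined) (hS : M.SuitablyConnected)
    (v : M.tree) :
    M.realization ∩ (M.frame v).map '' openSquare (M.dim v) ⊆ M.below v := by
  induction v using RootedTree.bot_induction with
  | hbot => rw [realization_eq_below_bot]; exact Set.inter_subset_left
  | hstep u w h ih =>
    rintro _ ⟨hx, z, hz, rfl⟩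
    obtain ⟨ε, H⟩ := exists_insertedMosaic hW hS u
    have hcol := (insert_mem_openColumn_iff hS h).2 hz
    have hu : M.insert h z ∈ M.localBelow u := by
      rw [localBelow, Set.mem_preimage]
      refine ih ⟨by rwa [frame_map_insert], _, Pos.openColumn_subset _ hcol, rfl⟩
    rw [localBelow_eq hS u] at hu
    obtain ⟨z', hz', he⟩ := H.mem_D_of_mem_openColumn (i := ⟨w, h⟩) hu hcol
    have := congrArg (M.frame u).map he
    rw [frame_map_insert, frame_map_insert] at this
    rw [← this]
    exact hz'

theorem isOpen_openSquare (n : ℕ) : IsOpen (openSquare n) := by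
  have h (i : Fin 3) : IsOpen {y : E3 | 0 < y i} := isOpen_lt continuous_const (by fun_prop)
  have h' (i : Fin 3) : IsOpen {y : E3 | y i < n} := isOpen_lt (by fun_prop) continuous_const
  exact (h 0).inter ((h' 0).inter ((h 1).inter (h' 1)))

/-- Near `x`, the realization consists of the subtree of `v` only, and this subtree contains
`x`. -/
def Localized (v : M.tree) (x : E3) : Prop :=
  x ∈ M.below v ∧ ∃ U ∈ 𝓝 x, M.realization ∩ U ⊆ M.below v

/-- If the realization has more than four branches at `x`, then `x` is a point of the subtree of a
child. -/
theorem Localized.exists_child (hW : M.WellDefined) (hS : M.SuitablyConnected) {v : M.tree} {x : E3}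
    (hv : Localized v x) (hx : ¬ BranchLE M.realization x 4) :
    ∃ w : M.tree, v ⋖ w ∧ Localized w x := by
  obtain ⟨hxv, U, hU, hUv⟩ := hv
  have hpos := scale_pos hS v
  obtain ⟨y, rfl⟩ := ((M.frame v).homeomorph hpos.ne').surjective x
  rw [Frame.coe_homeomorph] at *
  obtain ⟨ε, H⟩ := exists_insertedMosaic hW hS v
  by_contra hno
  refine hx (BranchLE.congr_nhds (A := (M.frame v).map '' M.localBelow v) ?_ hU fun z hz => ?_)
  · refine BranchLE.image_homothety hpos _ ?_
    rw [localBelow_eq hS v]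
    refine H.branchLE_four (fun w hyw ho => ?_) fun w hyw ho => hno ⟨w, w.2, ?_⟩
    · obtain ⟨z, hz, rfl⟩ := hyw
      have hd := three_le_dim hS w.2
      rw [insert_mem_openColumn_iff hS w.2] at ho
      obtain ⟨h2, hz2⟩ := branchLE_localBelow_two hW hS hz ho
      refine ⟨h2.image_homothety (inv_pos.2 (by linarith)) _, ?_⟩
      simp only [insert, PiLp.add_apply, PiLp.smul_apply, smul_eq_mul, Pos.corner_two, add_zero,
        hz2]
      rw [inv_mul_lt_iff₀ (by linarith)]
      linarith
    · obtain ⟨z, hz, rfl⟩ := hyw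
      rw [insert_mem_openColumn_iff hS w.2] at ho
      rw [frame_map_insert]
      refine ⟨hz, _, ?_, realization_inter_subset_below hW hS w⟩
      exact ((M.frame w).homeomorph (scale_pos hS w).ne').isOpenMap.image_mem_nhds
        ((isOpen_openSquare _).mem_nhds ho)
  · obtain ⟨z', rfl⟩ := ((M.frame v).homeomorph hpos.ne').surjective z
    exact ⟨z', hUv hz, rfl⟩

/-- Around every point of the realization there are arbitrarily small tame balls the boundary of
which meets the realization in at most four points. -/
theorem exists_ball (hW : M.WellDefined) (hS : M.SuitablyConnected) {x : E3}
    (hx : x ∈ M.realization) {V : Set E3} (hV : V ∈ 𝓝 x) :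
    ∃ g : E3 ≃ₜ E3, g '' Metric.closedBall 0 1 ∈ 𝓝 x ∧ g '' Metric.closedBall 0 1 ⊆ V ∧
      (M.realization ∩ frontier (g '' Metric.closedBall 0 1)).encard ≤ (4 : ℕ) := by
  by_cases hbr : BranchLE M.realization x 4
  · exact BranchLE.exists_ball hbr hV
  -- `x` belongs to an infinite descending path of inserted mosaics
  have hdesc : ∀ k : ℕ, ∃ v : M.tree, Localized v x ∧ (M.frame v).scale ≤ (1/3) ^ k := by
    intro k
    induction k with
    | zero =>
      refine ⟨⊥, ⟨by rwa [← realization_eq_below_bot], Set.univ, Filter.univ_mem, ?_⟩, ?_⟩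
      · rw [realization_eq_below_bot]; exact Set.inter_subset_left
      · rw [frame_bot]; simp
    | succ k ih =>
      obtain ⟨v, hv, hk⟩ := ih
      obtain ⟨w, hvw, hw⟩ := hv.exists_child hW hS hbr
      refine ⟨w, hw, ?_⟩
      have h3 := three_le_dim hS hvw
      rw [scale_of_covBy hvw, div_le_iff₀ (by linarith), pow_succ]
      have : (0 : ℝ) ≤ (1/3) ^ k := by positivity
      nlinarith
  obtain ⟨η, hη, hηV⟩ := Metric.mem_nhds_iff.1 hV
  obtain ⟨k, hk⟩ := exists_pow_lt_of_lt_one (show (0 : ℝ) < η / 6 by positivity)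
    (show (1/3 : ℝ) < 1 by norm_num)
  obtain ⟨v, hv, hvk⟩ := hdesc k
  obtain ⟨w, hvw, hw⟩ := hv.exists_child hW hS hbr
  obtain ⟨ε, H⟩ := exists_insertedMosaic hW hS v
  have hpos := scale_pos hS v
  set φ := (M.frame v).homeomorph hpos.ne' with hφ
  obtain ⟨z, hz⟩ := ((M.frame w).homeomorph (scale_pos hS w).ne').surjective x
  rw [Frame.coe_homeomorph] at hz
  have hzw : z ∈ M.localBelow w := by
    rw [localBelow, Set.mem_preimage, hz]
    exact hw.1
  have hxy : φ (M.insert hvw z) = x := by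
    rw [hφ, Frame.coe_homeomorph, frame_map_insert, hz]
  -- the enlarged cube of the tile
  set δ : ℝ := min (1/8) (ε/4) with hδ
  have hδ0 : 0 < δ := lt_min (by norm_num) (by linarith [H.eps_pos])
  have hδ8 : δ ≤ 1/8 := min_le_left _ _
  have hδε : δ ≤ ε/4 := min_le_right _ _
  set B := (M.target hvw).box δ with hB
  have hint : M.insert hvw z ∈ interior B :=
    Pos.cutCube_subset_interior_box hδ0 _
      (insert_mem_cutCube hS hvw (localBelow_subset_cutSlab hW hS w hzw))
  obtain ⟨g, hg⟩ := exists_homeomorph_image_closedBall_eq (Pos.convex_box δ (M.target hvw))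
    (Pos.isCompact_box (by linarith) _) ⟨_, hint⟩
  have hgB : (g.trans φ) '' Metric.closedBall 0 1 = φ '' B := by
    rw [hB, ← hg, Set.image_image]
    rfl
  refine ⟨g.trans φ, ?_⟩
  rw [hgB, ← φ.image_frontier]
  refine ⟨?_, ?_, ?_⟩
  · rw [← hxy]
    exact φ.isOpenMap.image_mem_nhds (mem_interior_iff_mem_nhds.1 hint)
  · rintro _ ⟨y, hy, rfl⟩
    refine hηV ?_
    rw [Metric.mem_ball, ← hxy, hφ, Frame.coe_homeomorph, Frame.map_eq, dist_add_right, dist_smul₀,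
      Real.norm_of_nonneg hpos.le]
    have := Pos.dist_le_of_mem_box (by linarith) hy (interior_subset hint)
    nlinarith
  · have hsub : M.realization ∩ φ '' frontier B ⊆ φ '' (M.localBelow v ∩ frontier B) := by
      rintro _ ⟨hR, y, hy, rfl⟩
      refine ⟨y, ⟨?_, hy⟩, rfl⟩
      have hyB : y ∈ B := (Pos.isClosed_box δ _).frontier_subset hy
      exact realization_inter_subset_below hW hS v
        ⟨hR, y, (H.inner ⟨w, hvw⟩).box_subset (by linarith) hyB, rfl⟩
    refine (Set.encard_le_encard hsub).trans ?_
    rw [φ.injective.encard_image, localBelow_eq hS v]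
    exact H.encard_inter_frontier_box_le ⟨w, hvw⟩ hδ0 (by linarith) (by linarith [H.eps_pos])

end TreeMosaic

theorem mainTheorem2 :
    (∀ K : Set E3, IsLink K → (∃ p ∈ K, 4 < pIndex id K p) →
      ¬ ∃ M : TreeMosaic.{u}, M.Represents id K) ∧
    (∀ K : Set (OnePoint E3), IsLink K → (∃ p ∈ K, 4 < pIndex ((↑) : E3 → OnePoint E3) K p) →
      ¬ ∃ M : TreeMosaic.{u}, M.Represents ((↑) : E3 → OnePoint E3) K) := by
  constructor
  · rintro K - ⟨p, hp, h4⟩ ⟨M, hW, hS, h, rfl⟩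
    exact h4.not_ge (pIndex_image_le (N := 4) IsOpenEmbedding.id (fun g => ⟨g, fun _ => rfl⟩)
      (fun x hx V hV => M.exists_ball hW hS hx hV) h hp)
  · rintro K - ⟨p, hp, h4⟩ ⟨M, hW, hS, h, rfl⟩
    exact h4.not_ge (pIndex_image_le (N := 4) OnePoint.isOpenEmbedding_coe
      (fun g => ⟨g.onePointCongr, fun _ => rfl⟩)
      (fun x hx V hV => M.exists_ball hW hS hx hV) h hp)
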